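/- **Setting.** Let $n\ge 1$, $0<s<1$ and $\delta>0$. Let $\Omega\subset\mathbb R^n$ be a bounded open set, $\Omega_\delta=\Omega+B(0,\delta)$ and $\Omega_{-\delta}=\{x\in\Omega:\operatorname{dist}(x,\partial\Omega)>\delta\}$. Let $w_\delta\in C_c^\infty(B(0,\delta))$ be radial and nonnegative, with $w_\delta(x_1)\ge w_\delta(x_2)$ whenever $|x_1|\le|x_2|$, and such that for some $a_0>0$ and $0<b_0<1$ one has $0\le w_\delta\le a_0$ and $w_\delta=a_0$ on $B(0,b_0\delta)$. Put $$c_{n,s}=\frac{n-1+s}{\gamma(1-s)},\qquad \gamma(\sigma)=\frac{\pi^{n/2}\,2^{\sigma}\,\Gamma(\sigma/2)}{\Gamma((n-\sigma)/2)} .$$ For $\varphi:\mathbb R^n\to\mathbb R$ and $u,f:\mathbb R^n\to\mathbb R^n$ (whenever the integrals converge absolutely, as they do for $C_c^1$ functions), set $$D^s_\delta \varphi(x)=c_{n,s}\int_{B(x,\delta)}\frac{\varphi(x)-\varphi(y)}{|x-y|}\,\frac{x-y}{|x-y|}\,\frac{w_\delta(x-y)}{|x-y|^{n-1+s}}\,dy,$$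 $$D^s_\delta u(x)=c_{n,s}\int_{B(x,\delta)}\frac{u(x)-u(y)}{|x-y|}\otimes\frac{x-y}{|x-y|}\,\frac{w_\delta(x-y)}{|x-y|^{n-1+s}}\,dy,$$ $$\operatorname{div}^s_\delta f(x)=c_{n,s}\int_{B(x,\delta)}\frac{f(x)-f(y)}{|x-y|}\cdot\frac{x-y}{|x-y|}\,\frac{w_\delta(x-y)}{|x-y|^{n-1+s}}\,dy .$$ Thus the $i$-th row of the matrix $D^s_\delta u$ is $D^s_\delta u_i$. Likewise $(Du)_{ij}=\partial_ju_i$. The divergence and the nonlocal divergence of a matrix field are the vectors formed by those of its rows. The cofactor matrix $\operatorname{cof}A$ is the transpose of the adjugate of $A$, so that $\operatorname{cof}A\,A^T=(\det A)I$. For $1\le p<\infty$, $H^{s,p,\delta}(\Omega)$ is the closure of $C_c^\infty(\mathbb R^n)$ under the norm $\big(\|u\|_{L^p(\Omega_\delta)}^p+\|D^s_\delta u\|_{L^p(\Omega)}^p\big)^{1/p}$. If $u\in L^1(\Omega_\delta)$ and there are $u_k\in C_c^\infty(\mathbb R^n)$ with $u_k\to u$ in $L^1(\Omega_\delta)$ and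 $D^s_\delta u_k\to U$ in $L^1(\Omega,\mathbb R^n)$, then $D^s_\delta u:=U$ (a.e. in $\Omega$). A vector field belongs to $H^{s,p,\delta}(\Omega,\mathbb R^n)$ if its components belong to $H^{s,p,\delta}(\Omega)$, and its $D^s_\delta$ is the matrix whose rows are the nonlocal gradients of the components. **Proposition 4.1 (nonlocal Piola identity).** a) For all $u\in C_c^\infty(\mathbb R^n,\mathbb R^n)$, at every point of $\mathbb R^n$, $$\operatorname{div}^s_\delta\operatorname{cof}D^s_\delta u=\operatorname{div}\operatorname{cof}D^s_\delta u=\operatorname{div}^s_\delta\operatorname{cof}Du=0,$$ where $\operatorname{cof}D^s_\delta u$ is of class $C^1$ and the integrals defining the two nonlocal divergences converge absolutely. b) Let $1\le p<\infty$ with $p\ge n-1$, and let $u\in H^{s,p,\delta}(\Omega,\mathbb R^n)$. Then for all $\varphi\in C_c^\infty(\Omega_{-\delta})$, $$\int_\Omega \operatorname{cof}D^s_\delta u\;D^s_\delta\varphi\,dx=0,$$ and for all $\varphi\in C_c^\infty(\Omega)$, $$\int_\Omega \operatorname{cof}D^s_\delta u\;D\varphi\,dx=0,$$ where both integrands (matrix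 times vector) are integrable on $\Omega$. -/

import Mathlib

open MeasureTheory Filter Topology
open scoped ContDiff

noncomputable section

namespace NonlocalPiola

/-- The Euclidean space `ℝⁿ`. -/
abbrev E (n : ℕ) : Type := EuclideanSpace ℝ (Fin n)

variable {n : ℕ}

/-- `γ(σ) = π^{n/2} 2^σ Γ(σ/2) / Γ((n-σ)/2)`. -/
def gammaConst (n : ℕ) (σ : ℝ) : ℝ :=
  Real.pi ^ ((n : ℝ) / 2) * (2 : ℝ) ^ σ * Real.Gamma (σ / 2) / Real.Gamma (((n : ℝ) - σ) / 2)

/-- `c_{n,s} = (n-1+s) / γ(1-s)`. -/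
def cConst (n : ℕ) (s : ℝ) : ℝ :=
  ((n : ℝ) - 1 + s) / gammaConst n (1 - s)

/-- The admissible cut-off functions `w_δ` with horizon `δ`. -/
structure IsCutoff (δ : ℝ) (w : E n → ℝ) : Prop where
  nonneg : ∀ x, 0 ≤ w x
  radial : ∀ x y, ‖x‖ = ‖y‖ → w x = w y
  smooth : ContDiff ℝ ∞ w
  compact : HasCompactSupport w
  support_subset : tsupport w ⊆ Metric.ball 0 δ
  plateau : ∃ a₀ b₀ : ℝ, 0 < a₀ ∧ 0 < b₀ ∧ b₀ < 1 ∧ (∀ x, w x ≤ a₀) ∧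
    ∀ x ∈ Metric.ball (0 : E n) (b₀ * δ), w x = a₀
  antitone : ∀ x₁ x₂, ‖x₁‖ ≤ ‖x₂‖ → w x₂ ≤ w x₁

/-- `C_c^∞(V, F)`, as functions on the whole space that vanish outside a compact subset of `V`. -/
def IsTest {F : Type*} [NormedAddCommGroup F] [NormedSpace ℝ F] (V : Set (E n)) (φ : E n → F) :
    Prop :=
  ContDiff ℝ ∞ φ ∧ HasCompactSupport φ ∧ tsupport φ ⊆ V

/-! Nonlocal operators given by the integral formulas. -/

/-- Nonlocal gradient of a scalar function,
`c_{n,s} ∫_{B(x,δ)} (u(x)-u(y))/|x-y| (x-y)/|x-y| w(x-y)/|x-y|^{n-1+s} dy`. -/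
def nlGrad (s δ : ℝ) (w : E n → ℝ) (u : E n → ℝ) (x : E n) : E n :=
  cConst n s • ∫ y in Metric.ball x δ,
    ((u x - u y) / ‖x - y‖ * (w (x - y) / ‖x - y‖ ^ ((n : ℝ) - 1 + s))) •
      (‖x - y‖⁻¹ • (x - y))

/-- Nonlocal gradient of a vector function: the matrix whose `i`-th row is the nonlocal
gradient of the `i`-th component, as in `(u(x)-u(y)) ⊗ (x-y)`. -/
def nlGradMat (s δ : ℝ) (w : E n → ℝ) (u : E n → E n) (x : E n) : Matrix (Fin n) (Fin n) ℝ :=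
  Matrix.of fun i j => nlGrad s δ w (fun z => u z i) x j

/-- The integrand (in `y`) of the nonlocal divergence at `x`. -/
def nlDivIntegrand (s : ℝ) (w : E n → ℝ) (f : E n → E n) (x y : E n) : ℝ :=
  inner ℝ (‖x - y‖⁻¹ • (f x - f y)) (‖x - y‖⁻¹ • (x - y)) *
    (w (x - y) / ‖x - y‖ ^ ((n : ℝ) - 1 + s))

/-- Nonlocal divergence of a vector field. -/
def nlDiv (s δ : ℝ) (w : E n → ℝ) (f : E n → E n) (x : E n) : ℝ :=
  cConst n s * ∫ y in Metric.ball x δ, nlDivIntegrand s w f x y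

/-- The `i`-th row of a matrix field, as a vector field. -/
def row (M : E n → Matrix (Fin n) (Fin n) ℝ) (i : Fin n) (x : E n) : E n :=
  WithLp.toLp 2 (M x i)

/-- Nonlocal divergence of a matrix field: the vector of the nonlocal divergences of the rows. -/
def nlDivMat (s δ : ℝ) (w : E n → ℝ) (M : E n → Matrix (Fin n) (Fin n) ℝ) (x : E n) :
    Fin n → ℝ :=
  fun i => nlDiv s δ w (row M i) x

/-! Classical objects. -/

/-- The Jacobian matrix `(Du)_{ij} = ∂_j u_i`. -/
def jacobian (u : E n → E n) (x : E n) : Matrix (Fin n) (Fin n) ℝ :=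
  Matrix.of fun i j => fderiv ℝ u x (EuclideanSpace.single j 1) i

/-- Divergence of a matrix field: the vector of the divergences of the rows. -/
def divMat (M : E n → Matrix (Fin n) (Fin n) ℝ) (x : E n) : Fin n → ℝ :=
  fun i => ∑ j, fderiv ℝ (fun z => M z i j) x (EuclideanSpace.single j 1)

/-- The cofactor matrix; `cof A * Aᵀ = det A • 1`. -/
def cof (A : Matrix (Fin n) (Fin n) ℝ) : Matrix (Fin n) (Fin n) ℝ :=
  A.adjugate.transpose

/-! The space `H^{s,p,δ}(Ω)`. -/

/-- `Ω_δ = Ω + B(0,δ)`. -/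
def outset (δ : ℝ) (Ω : Set (E n)) : Set (E n) := Metric.thickening δ Ω

/-- `Ω_{-δ} = {x ∈ Ω : dist(x, ∂Ω) > δ}`. -/
def inset (δ : ℝ) (Ω : Set (E n)) : Set (E n) := {x ∈ Ω | δ < Metric.infDist x (frontier Ω)}

/-- `u ∈ L^p(Ω_δ)`, `U ∈ L^p(Ω, ℝⁿ)`, and there are `v_k ∈ C_c^∞(ℝⁿ)` with `v_k → u` in
`L^p(Ω_δ)` and `D^s_δ v_k → U` in `L^p(Ω, ℝⁿ)`. -/
def IsGradLimit (s δ : ℝ) (w : E n → ℝ) (Ω : Set (E n)) (p : ℝ) (u : E n → ℝ) (U : E n → E n) :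
    Prop :=
  MemLp u (ENNReal.ofReal p) (volume.restrict (outset δ Ω)) ∧
  MemLp U (ENNReal.ofReal p) (volume.restrict Ω) ∧
  ∃ v : ℕ → E n → ℝ, (∀ k, IsTest Set.univ (v k)) ∧
    Tendsto (fun k => eLpNorm (fun x => v k x - u x) (ENNReal.ofReal p)
      (volume.restrict (outset δ Ω))) atTop (𝓝 0) ∧
    Tendsto (fun k => eLpNorm (fun x => nlGrad s δ w (v k) x - U x) (ENNReal.ofReal p)
      (volume.restrict Ω)) atTop (𝓝 0)

/-- `U` is (a representative on `Ω` of) the nonlocal gradient of `u ∈ L¹(Ω_δ)`: it is the `L¹`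
limit of the nonlocal gradients of smooth functions that converge to `u` in `L¹(Ω_δ)`. -/
def IsNlGrad (s δ : ℝ) (w : E n → ℝ) (Ω : Set (E n)) (u : E n → ℝ) (U : E n → E n) : Prop :=
  IsGradLimit s δ w Ω 1 u U

/-- `u ∈ H^{s,p,δ}(Ω)`: `u` lies in the closure of `C_c^∞(ℝⁿ)` for the norm
`(‖u‖_{L^p(Ω_δ)}^p + ‖D^s_δ u‖_{L^p(Ω)}^p)^{1/p}`. -/
def MemH (s δ : ℝ) (w : E n → ℝ) (Ω : Set (E n)) (p : ℝ) (u : E n → ℝ) : Prop :=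
  ∃ U : E n → E n, IsGradLimit s δ w Ω p u U

end NonlocalPiola

end

open NonlocalPiola

/-!
The vector kernel of the nonlocal gradient is `K(z) = w(z) ‖z‖^{-(n+1+s)} z`. Up to the factor
`c_{n,s}`, the nonlocal gradient and divergence are the operators
`f ↦ ∫ K_j(z) (f(x) - f(x - z)) dz` (`nlOp (gradKernel s w j)`), which make sense for `C¹` functions
because `‖z‖ ‖K(z)‖` is integrable, and which commute with differentiation.

The field `K` is radial, hence minus the gradient of a potential. To avoid singular potentials,
`‖z‖` is replaced by `max ‖z‖ ε` in the profile of `K`: the truncated field is `-∇Q` with `Q` of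
class `C¹` and of compact support (`exists_potential`), and one integration by parts turns the
truncated operator into the convolution `Q * ∂_j f`. As `ε → 0` this gives two facts:

* the nonlocal divergence of a divergence-free `C¹` field vanishes, since it is the limit of
  `Q * div f` (`sum_nlOp_eq_zero_of_div_eq_zero`);
* the nonlocal gradient is curl-free, since `∂_i` of its `j`-th component is the limit of
  `Q * ∂_i ∂_j f` (`fderiv_nlOp_comm`).

A `C¹` matrix field with curl-free rows has a divergence-free cofactor matrix: the derivative of a
cofactor is a sum of determinants alternating in two rows, contracted with the symmetric array of
derivatives of a row (`sum_fderiv_cof_eq_zero`). This applies to `D^s_δ u` and to `Du`, and part a)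
follows.

For smooth fields, part b) is integration by parts, with the antisymmetry of the nonlocal
derivatives in the `L²` pairing (`IsKernel.integral_nlOp_mul`) in the nonlocal case. For fields of
`H^{s,p,δ}(Ω)` one approximates: cofactors are sums of products of `n - 1 ≤ p` entries, so by
Hölder's inequality the cofactors of the approximations converge in `L¹(Ω)` (`TendstoLp.cof`). The
given nonlocal gradient, a limit in `L¹` along some other sequence, agrees with the limit in `L^p`
because both satisfy the nonlocal integration by parts formula (`IsGradLimit.ae_eq`).
-/

namespace NonlocalPiola

/-! ### Difference operators with a singular kernel -/

section

variable {n : ℕ} {F : Type*} [NormedAddCommGroup F] [NormedSpace ℝ F]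

/-- A kernel on `ℝⁿ` with horizon `δ` whose singularity at the origin is integrable after
multiplication by `‖z‖`, so that it may be integrated against increments of `C¹` functions. -/
structure IsKernel (δ : ℝ) (k : E n → ℝ) : Prop where
  meas : Measurable k
  integrable : Integrable fun z => ‖z‖ * |k z|
  eq_zero : ∀ z, δ ≤ ‖z‖ → k z = 0

/-- The difference operator `f ↦ ∫ k(z) (f(x) - f(x - z)) dz` with kernel `k`. -/
noncomputable def nlOp (k : E n → ℝ) (f : E n → F) (x : E n) : F :=
  ∫ z, k z • (f x - f (x - z))

theorem exists_lipschitz_closedBall {f : E n → F} (hf : ContDiff ℝ 1 f) (R : ℝ) :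
    ∃ L, ∀ x y, ‖x‖ ≤ R → ‖y‖ ≤ R → ‖f x - f y‖ ≤ L * ‖x - y‖ := by
  obtain ⟨L, hL⟩ := (isCompact_closedBall (0 : E n) R).exists_bound_of_continuousOn
    (hf.continuous_fderiv one_ne_zero).continuousOn
  refine ⟨L, fun x y hx hy => ?_⟩
  refine (convex_closedBall (0 : E n) R).norm_image_sub_le_of_norm_fderiv_le (𝕜 := ℝ)
    (fun z _ => hf.differentiable one_ne_zero z) hL
    (mem_closedBall_zero_iff.2 hy) (mem_closedBall_zero_iff.2 hx)

namespace IsKernel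

variable {δ : ℝ} {k : E n → ℝ}

theorem norm_smul_sub_le (hk : IsKernel δ k) {f : E n → F} {L R : ℝ}
    (hL : ∀ x y, ‖x‖ ≤ R + |δ| → ‖y‖ ≤ R + |δ| → ‖f x - f y‖ ≤ L * ‖x - y‖)
    {x : E n} (hx : ‖x‖ ≤ R) (z : E n) :
    ‖k z • (f x - f (x - z))‖ ≤ L * (‖z‖ * |k z|) := by
  by_cases hz : δ ≤ ‖z‖
  · simp [hk.eq_zero z hz]
  · have h1 : ‖x - z‖ ≤ R + |δ| :=
      (norm_sub_le _ _).trans (add_le_add hx ((not_le.1 hz).le.trans (le_abs_self _)))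
    have h2 := hL x (x - z) (hx.trans (le_add_of_nonneg_right (abs_nonneg _))) h1
    rw [sub_sub_cancel] at h2
    rw [norm_smul, Real.norm_eq_abs]
    nlinarith [abs_nonneg (k z)]

theorem aestronglyMeasurable_smul_sub (hk : IsKernel δ k) {f : E n → F} (hf : Continuous f)
    (x : E n) : AEStronglyMeasurable (fun z => k z • (f x - f (x - z))) :=
  hk.meas.aestronglyMeasurable.smul
    (by fun_prop : Continuous fun z => f x - f (x - z)).aestronglyMeasurable

theorem integrable_smul_sub (hk : IsKernel δ k) {f : E n → F} (hf : ContDiff ℝ 1 f) (x : E n) :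
    Integrable fun z => k z • (f x - f (x - z)) := by
  obtain ⟨L, hL⟩ := exists_lipschitz_closedBall hf (‖x‖ + |δ|)
  exact (hk.integrable.const_mul L).mono' (hk.aestronglyMeasurable_smul_sub hf.continuous x)
    (ae_of_all _ (hk.norm_smul_sub_le hL le_rfl))

theorem norm_le_of_mem_ball {x y : E n} (hy : y ∈ Metric.ball x 1) : ‖y‖ ≤ ‖x‖ + 1 := by
  have := norm_add_le x (y - x)
  rw [add_sub_cancel, ← dist_eq_norm] at this
  exact this.trans (by gcongr; exact (Metric.mem_ball.1 hy).le)

theorem continuous_nlOp (hk : IsKernel δ k) {f : E n → F} (hf : ContDiff ℝ 1 f) :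
    Continuous (nlOp k f) := by
  refine continuous_iff_continuousAt.2 fun x => ?_
  obtain ⟨L, hL⟩ := exists_lipschitz_closedBall hf (‖x‖ + 1 + |δ|)
  refine continuousAt_of_dominated (bound := fun z => L * (‖z‖ * |k z|))
    (Eventually.of_forall fun y => hk.aestronglyMeasurable_smul_sub hf.continuous y) ?_
    (hk.integrable.const_mul L) (ae_of_all _ fun z => ?_)
  · filter_upwards [Metric.ball_mem_nhds x one_pos] with y hy
    exact ae_of_all _ (hk.norm_smul_sub_le hL (norm_le_of_mem_ball hy))
  · have := hf.continuous
    fun_prop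

/-- The operator `nlOp k` commutes with differentiation. -/
theorem hasFDerivAt_nlOp (hk : IsKernel δ k) {f : E n → F} (hf : ContDiff ℝ 2 f) (x : E n) :
    HasFDerivAt (nlOp k f) (nlOp k (fderiv ℝ f) x) x := by
  have hf1 : ContDiff ℝ 1 f := hf.of_le one_le_two
  have hf' : ContDiff ℝ 1 (fderiv ℝ f) := hf.fderiv_right (by norm_num [one_add_one_eq_two])
  obtain ⟨L, hL⟩ := exists_lipschitz_closedBall hf' (‖x‖ + 1 + |δ|)
  refine hasFDerivAt_integral_of_dominated_of_fderiv_le (𝕜 := ℝ)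
    (bound := fun z => L * (‖z‖ * |k z|))
    (F' := fun y z => k z • (fderiv ℝ f y - fderiv ℝ f (y - z)))
    (Metric.ball_mem_nhds x one_pos)
    (Eventually.of_forall fun y => hk.aestronglyMeasurable_smul_sub hf.continuous y)
    (hk.integrable_smul_sub hf1 x) (hk.aestronglyMeasurable_smul_sub hf'.continuous x)
    (ae_of_all _ fun z y hy => hk.norm_smul_sub_le hL (norm_le_of_mem_ball hy) z)
    (hk.integrable.const_mul L) (ae_of_all _ fun z y _ => ?_)
  have hd : Differentiable ℝ f := hf1.differentiable one_ne_zero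
  exact ((hd y).hasFDerivAt.sub
    ((hasFDerivAt_comp_sub z).2 (hd (y - z)).hasFDerivAt)).const_smul (k z)

theorem contDiff_nlOp (hk : IsKernel δ k) {f : E n → F} (hf : ContDiff ℝ 2 f) :
    ContDiff ℝ 1 (nlOp k f) := by
  rw [contDiff_one_iff_fderiv]
  refine ⟨fun x => (hk.hasFDerivAt_nlOp hf x).differentiableAt, ?_⟩
  rw [show fderiv ℝ (nlOp k f) = nlOp k (fderiv ℝ f) from
    funext fun x => (hk.hasFDerivAt_nlOp hf x).fderiv]
  exact hk.continuous_nlOp (hf.fderiv_right (by norm_num [one_add_one_eq_two]))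

theorem fderiv_nlOp_apply [CompleteSpace F] (hk : IsKernel δ k) {f : E n → F} (hf : ContDiff ℝ 2 f)
    (x v : E n) : fderiv ℝ (nlOp k f) x v = nlOp k (fun y => fderiv ℝ f y v) x := by
  rw [(hk.hasFDerivAt_nlOp hf x).fderiv, nlOp, nlOp, ContinuousLinearMap.integral_apply
    (hk.integrable_smul_sub (hf.fderiv_right (by norm_num [one_add_one_eq_two])) x)]
  rfl

theorem nlOp_eq_zero (hk : IsKernel δ k) {f : E n → F} {x : E n} (hδ : 0 < δ)
    (hx : ∀ y, dist x y < δ → f y = 0) : nlOp k f x = 0 := by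
  refine integral_eq_zero_of_ae (ae_of_all _ fun z => ?_)
  by_cases hz : δ ≤ ‖z‖
  · simp [hk.eq_zero z hz]
  · simp [hx x (by simpa using hδ), hx (x - z) (by simpa [dist_eq_norm] using hz)]

/-- For an odd kernel, `nlOp k` is antisymmetric with respect to the `L²` pairing: by Fubini, a
translation in `x` moves the increment from `v` to `φ` and a reflection in `z` restores its form. -/
theorem integral_nlOp_mul (hk : IsKernel δ k) (hodd : ∀ z, k (-z) = -k z) {v φ : E n → ℝ}
    (hv : ContDiff ℝ 1 v) (hφ : ContDiff ℝ 1 φ) (hφc : HasCompactSupport φ) :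
    ∫ x, nlOp k v x * φ x = -∫ x, v x * nlOp k φ x := by
  have hvc := hv.continuous
  have hφc' := hφ.continuous
  obtain ⟨R, hR⟩ := (hφc.isCompact.isBounded).exists_norm_le
  have hφ0 : ∀ x, R < ‖x‖ → φ x = 0 := fun x hx =>
    image_eq_zero_of_notMem_tsupport fun h => (hR x h).not_gt hx
  have hφi : Integrable φ := hφc'.integrable_of_hasCompactSupport hφc
  -- the two sides as iterated integrals, with the `z`-integral inside
  have hL : ∀ x, nlOp k v x * φ x = ∫ z, k z * ((v x - v (x - z)) * φ x) := fun x => by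
    rw [nlOp, ← integral_mul_const]
    simp only [smul_eq_mul, mul_assoc]
  have hRt : ∀ x, -(v x * nlOp k φ x) = ∫ z, k z * (v x * (φ x - φ (x + z))) := fun x => by
    rw [nlOp, ← integral_const_mul, ← integral_neg, ← integral_neg_eq_self]
    refine integral_congr_ae (ae_of_all _ fun z => ?_)
    simp only [hodd, smul_eq_mul, sub_neg_eq_add]
    ring
  have hinner : ∀ z, ∫ x, (v x - v (x - z)) * φ x = ∫ x, v x * (φ x - φ (x + z)) := fun z => by
    have i1 : Integrable fun x => v x * φ x :=
      (hvc.mul hφc').integrable_of_hasCompactSupport hφc.mul_left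
    have i2 : Integrable fun x => v (x - z) * φ x :=
      ((by fun_prop : Continuous fun x => v (x - z)).mul hφc').integrable_of_hasCompactSupport
        hφc.mul_left
    have i3 : Integrable fun x => v x * φ (x + z) := by
      simpa using i2.comp_add_right z
    have e : ∫ x, v (x - z) * φ x = ∫ x, v x * φ (x + z) := by
      rw [← integral_add_right_eq_self _ z]
      simp
    simp only [sub_mul, mul_sub]
    rw [integral_sub i1 i2, integral_sub i1 i3, e]
  rw [← integral_neg]
  simp only [hL, hRt]
  obtain ⟨Lv, hLv⟩ := exists_lipschitz_closedBall hv (R + |δ|)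
  obtain ⟨Lφ, hLφ⟩ := exists_lipschitz_closedBall hφ (R + |δ| + |δ|)
  obtain ⟨C, hC⟩ := (isCompact_closedBall (0 : E n) (R + |δ|)).exists_bound_of_continuousOn
    hvc.continuousOn
  have km : Measurable fun q : E n × E n => k q.2 := hk.meas.comp measurable_snd
  refine (integral_integral_swap ?_).trans
    (Eq.trans (integral_congr_ae (ae_of_all _ fun z => ?_)) (integral_integral_swap ?_).symm)
  rotate_left
  · simp only [integral_const_mul, hinner]
  · have hb := ((integrable_indicator_iff (Metric.isClosed_closedBall.measurableSet)).2
      (integrableOn_const (μ := volume) (s := Metric.closedBall (0 : E n) (R + |δ|)) (C := C * Lφ)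
        (measure_closedBall_lt_top.ne))).mul_prod hk.integrable
    refine hb.mono' (km.mul (by fun_prop : Continuous fun q : E n × E n =>
      v q.1 * (φ q.1 - φ (q.1 + q.2))).measurable).aestronglyMeasurable (ae_of_all _ ?_)
    rintro ⟨x, z⟩
    simp only [Function.uncurry]
    by_cases hz : δ ≤ ‖z‖
    · simp [hk.eq_zero z hz]
    have hz' : ‖z‖ ≤ |δ| := (not_le.1 hz).le.trans (le_abs_self _)
    by_cases hx : ‖x‖ ≤ R + |δ|
    · rw [Set.indicator_of_mem (mem_closedBall_zero_iff.2 hx)]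
      have h1 := hC x (mem_closedBall_zero_iff.2 hx)
      have h2 := hLφ x (x + z) (hx.trans (le_add_of_nonneg_right (abs_nonneg _)))
        ((norm_add_le _ _).trans (add_le_add hx hz'))
      rw [sub_add_cancel_left, norm_neg] at h2
      have hC0 : 0 ≤ C := (norm_nonneg _).trans h1
      calc ‖k z * (v x * (φ x - φ (x + z)))‖ = |k z| * (‖v x‖ * ‖φ x - φ (x + z)‖) := by
            simp [norm_mul]
        _ ≤ |k z| * (C * (Lφ * ‖z‖)) := by gcongr
        _ = _ := by ring
    · rw [Set.indicator_of_notMem (by simpa using hx)]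
      rw [not_le] at hx
      have h1 : φ x = 0 := hφ0 x (by linarith [abs_nonneg δ])
      have h2 : φ (x + z) = 0 := hφ0 _ (by
        have := norm_sub_norm_le x (-z)
        rw [sub_neg_eq_add, norm_neg] at this
        linarith)
      simp [h1, h2]
  · have hb := (hφi.norm.const_mul Lv).mul_prod hk.integrable
    refine hb.mono' (km.mul (by fun_prop : Continuous fun q : E n × E n =>
      (v q.1 - v (q.1 - q.2)) * φ q.1).measurable).aestronglyMeasurable (ae_of_all _ ?_)
    rintro ⟨x, z⟩
    simp only [Function.uncurry]
    by_cases hx : ‖x‖ ≤ R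
    · have h2 := hk.norm_smul_sub_le hLv hx z
      calc ‖k z * ((v x - v (x - z)) * φ x)‖ = ‖k z • (v x - v (x - z))‖ * ‖φ x‖ := by
            simp only [norm_mul, smul_eq_mul]; ring
        _ ≤ Lv * (‖z‖ * |k z|) * ‖φ x‖ := by gcongr
        _ = _ := by ring
    · simp [hφ0 x (not_le.1 hx)]

end IsKernel

end

/-! ### The kernel of the nonlocal gradient and its regular truncations -/

section

variable {n : ℕ}

/-- The component `z_j w(z) / ‖z‖^{n+1+s}` of the kernel of the nonlocal gradient. -/
noncomputable def gradKernel (s : ℝ) (w : E n → ℝ) (j : Fin n) (z : E n) : ℝ :=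
  w z / ‖z‖ ^ ((n : ℝ) - 1 + s) / ‖z‖ ^ 2 * z j

/-- The radial profile `w(z) / ‖z‖^{n+1+s}`, with `‖z‖` replaced by `max ‖z‖ ε`. -/
noncomputable def truncProfile (s : ℝ) (w : E n → ℝ) (ε : ℝ) (z : E n) : ℝ :=
  w z / max ‖z‖ ε ^ ((n : ℝ) - 1 + s) / max ‖z‖ ε ^ 2

section Potential

variable {δ : ℝ} {g : E n → ℝ}

/-- For a continuous radial function `g` with compact support, the field `-g(z) z` is the gradient
of a compactly supported potential, namely `z ↦ ½ ∫_{‖z‖²}^{δ²} g(√t) dt`. -/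
theorem exists_potential (hn : 1 ≤ n) (hδ : 0 < δ) (hg : Continuous g)
    (hrad : ∀ x y, ‖x‖ = ‖y‖ → g x = g y) (h0 : ∀ z, δ ≤ ‖z‖ → g z = 0) :
    ∃ Q : E n → ℝ, HasCompactSupport Q ∧ ContDiff ℝ 1 Q ∧
      ∀ z v, fderiv ℝ Q z v = -(g z * inner ℝ z v) := by
  set e : E n := EuclideanSpace.single ⟨0, hn⟩ 1 with he
  have hne : ∀ t : ℝ, ‖Real.sqrt t • e‖ = Real.sqrt t := fun t => by
    rw [norm_smul, he, PiLp.norm_single]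
    simp [abs_of_nonneg (Real.sqrt_nonneg t)]
  set p : ℝ → ℝ := fun t => g (Real.sqrt t • e) with hp
  have hpc : Continuous p := hg.comp (Real.continuous_sqrt.smul continuous_const)
  have hP : ∀ q, HasDerivAt (fun q => ∫ t in q..δ ^ 2, p t) (-p q) q := fun q =>
    intervalIntegral.integral_hasDerivAt_left (hpc.intervalIntegrable _ _)
      (hpc.stronglyMeasurableAtFilter _ _) hpc.continuousAt
  have hQ : ∀ z : E n, HasFDerivAt (fun z : E n => 2⁻¹ * ∫ t in ‖z‖ ^ 2..δ ^ 2, p t)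
      (-g z • innerSL ℝ z) z := fun z => by
    have h1 := ((hP (‖z‖ ^ 2)).comp_hasFDerivAt z
      (hasStrictFDerivAt_norm_sq z).hasFDerivAt).const_mul (2⁻¹ : ℝ)
    refine h1.congr_fderiv ?_
    have : p (‖z‖ ^ 2) = g z := by
      refine hrad _ _ ?_
      rw [hne, Real.sqrt_sq (norm_nonneg _)]
    ext v
    simp [this]
    ring
  refine ⟨_, ?_, ?_, fun z v => by rw [(hQ z).fderiv]; simp⟩
  · refine HasCompactSupport.of_support_subset_isCompact (isCompact_closedBall (0 : E n) δ) ?_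
    intro z hz
    rw [mem_closedBall_zero_iff]
    by_contra hlt
    rw [not_le] at hlt
    refine hz ?_
    have : ∫ t in ‖z‖ ^ 2..δ ^ 2, p t = ∫ t in ‖z‖ ^ 2..δ ^ 2, (0 : ℝ) := by
      refine intervalIntegral.integral_congr fun t ht => ?_
      have hle : δ ^ 2 ≤ ‖z‖ ^ 2 := by gcongr
      rw [Set.uIcc_of_ge hle] at ht
      refine h0 _ ?_
      rw [hne]
      exact Real.le_sqrt_of_sq_le ht.1
    simp [this]
  · rw [contDiff_one_iff_fderiv]
    refine ⟨fun z => (hQ z).differentiableAt, ?_⟩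
    rw [show fderiv ℝ _ = _ from funext fun z => (hQ z).fderiv]
    exact hg.neg.smul (innerSL ℝ).continuous

/-- The difference operator with kernel `-∂_j Q` is the convolution with `Q` of `∂_j f`. -/
theorem integral_mul_coord_mul_sub {Q : E n → ℝ} (hQc : HasCompactSupport Q)
    (hQ : ContDiff ℝ 1 Q) (hQg : ∀ z v, fderiv ℝ Q z v = -(g z * inner ℝ z v)) {f : E n → ℝ}
    (hf : ContDiff ℝ 1 f) (j : Fin n) (x : E n) :
    ∫ z, (g z * z j) * (f x - f (x - z)) =
      ∫ z, Q z * fderiv ℝ f (x - z) (EuclideanSpace.single j 1) := by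
  set h : E n → ℝ := fun z => f x - f (x - z) with hh
  have hhC : ContDiff ℝ 1 h := contDiff_const.sub (hf.comp (contDiff_const.sub contDiff_id))
  have hh' : ∀ z, fderiv ℝ h z = fderiv ℝ f (x - z) := fun z => by
    have hd : Differentiable ℝ f := hf.differentiable one_ne_zero
    have := ((hd (x - z)).hasFDerivAt.comp z ((hasFDerivAt_id z).const_sub x)).const_sub (f x)
    refine this.fderiv.trans ?_
    ext v
    simp
  set e : E n := EuclideanSpace.single j 1
  have hQ'c : Continuous fun z => fderiv ℝ Q z e :=
    (hQ.continuous_fderiv one_ne_zero).clm_apply continuous_const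
  have hh'c : Continuous fun z => fderiv ℝ h z e :=
    (hhC.continuous_fderiv one_ne_zero).clm_apply continuous_const
  have hQ's : HasCompactSupport fun z => fderiv ℝ Q z e := hQc.fderiv_apply ℝ e
  have key := integral_mul_fderiv_eq_neg_fderiv_mul_of_integrable (μ := volume) (f := Q) (g := h)
    (v := e)
    ((hQ'c.mul hhC.continuous).integrable_of_hasCompactSupport hQ's.mul_right)
    ((hQ.continuous.mul hh'c).integrable_of_hasCompactSupport hQc.mul_right)
    ((hQ.continuous.mul hhC.continuous).integrable_of_hasCompactSupport hQc.mul_right)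
    (fun z _ => hQ.differentiable one_ne_zero z) (fun z _ => hhC.differentiable one_ne_zero z)
  simp only [hh'] at key
  rw [key, ← integral_neg]
  refine integral_congr_ae (ae_of_all _ fun z => ?_)
  have : inner ℝ z e = z j := by simp [e, EuclideanSpace.inner_single_right]
  simp only [hQg, this]
  ring

end Potential

section Cutoff

variable {s δ : ℝ} {w : E n → ℝ}

theorem IsCutoff.eq_zero (hw : IsCutoff δ w) {z : E n} (hz : δ ≤ ‖z‖) : w z = 0 :=
  image_eq_zero_of_notMem_tsupport fun h =>
    (mem_ball_zero_iff.1 (hw.support_subset h)).not_ge hz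

theorem exponent_pos (hn : 1 ≤ n) (hs0 : 0 < s) : 0 < (n : ℝ) - 1 + s := by
  have : (1 : ℝ) ≤ n := by exact_mod_cast hn
  linarith

/-- `w(z) ‖z‖^{-(n-1+s)}` is integrable because `s < 1`. -/
theorem IsCutoff.integrable_div_norm_rpow (hw : IsCutoff δ w) (hn : 1 ≤ n) (hs1 : s < 1) :
    Integrable fun z => w z / ‖z‖ ^ ((n : ℝ) - 1 + s) := by
  obtain ⟨a, b, ha, hb, hb1, hwa, -⟩ := hw.plateau
  have : Nonempty (Fin n) := ⟨⟨0, hn⟩⟩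
  have : Nontrivial (E n) := inferInstance
  have hf : Integrable fun z : E n =>
      (Set.Iio δ).indicator (fun r : ℝ => a / r ^ ((n : ℝ) - 1 + s)) ‖z‖ := by
    rw [integrable_fun_norm_addHaar volume
      (f := (Set.Iio δ).indicator (fun r : ℝ => a / r ^ ((n : ℝ) - 1 + s)))]
    have h1 : IntegrableOn (fun r : ℝ => a * r ^ (-s)) (Set.Ioo 0 δ) := by
      rcases le_or_gt δ 0 with h | h
      · simp [Set.Ioo_eq_empty_of_le h]
      · exact ((intervalIntegral.integrableOn_Ioo_rpow_iff h).2 (by linarith)).const_mul a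
    rw [← integrable_indicator_iff measurableSet_Ioo] at h1
    rw [← integrable_indicator_iff measurableSet_Ioi]
    refine h1.congr (ae_of_all _ fun r => ?_)
    by_cases hr : 0 < r
    · by_cases hrδ : r < δ
      · have e : r ^ ((n : ℝ) - 1) = r ^ (n - 1) := by
          rw [← Real.rpow_natCast, Nat.cast_sub hn, Nat.cast_one]
        have : r ^ (n - 1) ≠ 0 := (pow_pos hr _).ne'
        simp only [Set.mem_Ioo, hr, hrδ, and_self, Set.indicator_of_mem, Set.mem_Ioi, Set.mem_Iio,
          finrank_euclideanSpace, Fintype.card_fin, smul_eq_mul, Real.rpow_add hr, e,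
          Real.rpow_neg hr.le]
        field_simp
      · simp [hr, hrδ]
    · simp [hr]
  refine hf.mono' ?_ (ae_of_all _ fun z => ?_)
  · exact (hw.smooth.continuous.measurable.div
      (measurable_norm.pow_const _)).aestronglyMeasurable
  · by_cases hz : δ ≤ ‖z‖
    · simp [hw.eq_zero hz, hz]
    · rw [Set.indicator_of_mem (Set.mem_Iio.2 (not_le.1 hz)), Real.norm_eq_abs,
        abs_of_nonneg (div_nonneg (hw.nonneg z) (by positivity))]
      gcongr
      exact hwa z

theorem abs_coord_le_norm (z : E n) (j : Fin n) : |z j| ≤ ‖z‖ := by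
  simpa using PiLp.norm_apply_le z j

theorem isKernel_gradKernel (hn : 1 ≤ n) (hs1 : s < 1) (hw : IsCutoff δ w) (j : Fin n) :
    IsKernel δ (gradKernel s w j) := by
  have hm : Measurable (gradKernel s w j) := by
    have := hw.smooth.continuous.measurable
    unfold gradKernel
    fun_prop
  refine ⟨hm, ?_, fun z hz => by simp [gradKernel, hw.eq_zero hz]⟩
  refine (hw.integrable_div_norm_rpow hn hs1).mono' (by fun_prop) (ae_of_all _ fun z => ?_)
  have hq : 0 ≤ w z / ‖z‖ ^ ((n : ℝ) - 1 + s) := div_nonneg (hw.nonneg z) (by positivity)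
  rw [Real.norm_eq_abs, abs_mul, abs_norm, abs_abs, gradKernel, abs_mul,
    abs_of_nonneg (by positivity)]
  rcases eq_or_ne z 0 with rfl | hz
  · simpa using hq
  have hz' : 0 < ‖z‖ := norm_pos_iff.2 hz
  calc ‖z‖ * (w z / ‖z‖ ^ ((n : ℝ) - 1 + s) / ‖z‖ ^ 2 * |z j|)
      ≤ ‖z‖ * (w z / ‖z‖ ^ ((n : ℝ) - 1 + s) / ‖z‖ ^ 2 * ‖z‖) := by
        gcongr; exact abs_coord_le_norm z j
    _ = _ := by field_simp

theorem gradKernel_neg (hw : IsCutoff δ w) (j : Fin n) (z : E n) :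
    gradKernel s w j (-z) = -gradKernel s w j z := by
  simp [gradKernel, hw.radial (-z) z (norm_neg z)]

theorem continuous_truncProfile (hw : IsCutoff δ w) {ε : ℝ} (hε : 0 < ε) :
    Continuous (truncProfile s w ε) := by
  have h : ∀ z : E n, max ‖z‖ ε ≠ 0 := fun z => (lt_max_of_lt_right hε).ne'
  have hc : Continuous fun z : E n => max ‖z‖ ε := by fun_prop
  refine (hw.smooth.continuous.div (hc.rpow_const fun z => Or.inl (h z)) fun z => ?_).div
    (hc.pow 2) fun z => pow_ne_zero _ (h z)
  exact (Real.rpow_pos_of_pos (lt_max_of_lt_right hε) _).ne'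

theorem abs_truncProfile_mul_le (hn : 1 ≤ n) (hs0 : 0 < s) (hw : IsCutoff δ w) (ε : ℝ)
    (j : Fin n) (z : E n) : |truncProfile s w ε z * z j| ≤ |gradKernel s w j z| := by
  rcases eq_or_ne z 0 with rfl | hz
  · simp
  have hz' : 0 < ‖z‖ := norm_pos_iff.2 hz
  have hm : ‖z‖ ≤ max ‖z‖ ε := le_max_left _ _
  have := hw.nonneg z
  have hm' : 0 < max ‖z‖ ε := hz'.trans_le hm
  have := exponent_pos hn hs0
  rw [gradKernel, truncProfile, abs_mul, abs_mul,
    abs_of_nonneg (a := w z / max ‖z‖ ε ^ _ / _) (by positivity),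
    abs_of_nonneg (a := w z / ‖z‖ ^ _ / _) (by positivity)]
  gcongr

/-- Potentials `Q` whose gradients approximate the kernel of the nonlocal gradient: the
corresponding nonlocal derivatives are limits of the convolutions `Q * ∂_j f`. -/
theorem exists_potentials (hn : 1 ≤ n) (hs0 : 0 < s) (hs1 : s < 1) (hδ : 0 < δ)
    (hw : IsCutoff δ w) :
    ∃ Q : ℕ → E n → ℝ, (∀ m, Continuous (Q m)) ∧ (∀ m, HasCompactSupport (Q m)) ∧
      ∀ f : E n → ℝ, ContDiff ℝ 1 f → ∀ j x,
        Tendsto (fun m => ∫ z, Q m z * fderiv ℝ f (x - z) (EuclideanSpace.single j 1)) atTop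
          (𝓝 (nlOp (gradKernel s w j) f x)) := by
  have hpos : ∀ m : ℕ, 0 < 1 / ((m : ℝ) + 1) := fun m => by positivity
  choose Q hQc hQ hQg using fun m : ℕ => exists_potential (g := truncProfile s w (1 / ((m : ℝ) + 1)))
    hn hδ (continuous_truncProfile hw (hpos m))
    (fun x y h => by simp only [truncProfile, h, hw.radial x y h])
    (fun z hz => by simp [truncProfile, hw.eq_zero hz])
  refine ⟨Q, fun m => (hQ m).continuous, hQc, fun f hf j x => ?_⟩
  have hk := isKernel_gradKernel hn hs1 hw j
  simp only [← integral_mul_coord_mul_sub (hQc _) (hQ _) (hQg _) hf j x]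
  have hfc := hf.continuous
  refine tendsto_integral_of_dominated_convergence
    (fun z => ‖gradKernel s w j z • (f x - f (x - z))‖) (fun m => ?_)
    (hk.integrable_smul_sub hf x).norm (fun m => ae_of_all _ fun z => ?_) (ae_of_all _ fun z => ?_)
  · have := continuous_truncProfile (s := s) hw (hpos m)
    exact (by fun_prop : Continuous _).aestronglyMeasurable
  · rw [norm_mul, norm_smul]
    gcongr
    exact abs_truncProfile_mul_le hn hs0 hw _ j z
  · refine tendsto_const_nhds.congr' ?_
    rcases eq_or_ne z 0 with rfl | hz
    · exact Eventually.of_forall fun m => by simp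
    -- the truncation is inactive at `z` as soon as `ε ≤ ‖z‖`
    have hev := (tendsto_one_div_add_atTop_nhds_zero_nat (𝕜 := ℝ)).eventually
      (ge_mem_nhds (norm_pos_iff.2 hz))
    filter_upwards [hev] with m hm
    simp only [gradKernel, truncProfile, max_eq_left hm, smul_eq_mul]

/-- The nonlocal divergence of a divergence-free field vanishes. -/
theorem sum_nlOp_eq_zero_of_div_eq_zero (hn : 1 ≤ n) (hs0 : 0 < s) (hs1 : s < 1) (hδ : 0 < δ)
    (hw : IsCutoff δ w) {f : Fin n → E n → ℝ} (hf : ∀ j, ContDiff ℝ 1 (f j))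
    (hdiv : ∀ x, ∑ j, fderiv ℝ (f j) x (EuclideanSpace.single j 1) = 0) (x : E n) :
    ∑ j, nlOp (gradKernel s w j) (f j) x = 0 := by
  obtain ⟨Q, hQ, hQc, hlim⟩ := exists_potentials hn hs0 hs1 hδ hw
  refine tendsto_nhds_unique (tendsto_finsetSum _ fun j _ => hlim (f j) (hf j) j x) ?_
  refine tendsto_const_nhds.congr fun m => ?_
  rw [← integral_finsetSum]
  · simp only [← Finset.mul_sum, hdiv, mul_zero, integral_zero]
  · intro j _
    have hc : Continuous fun z => fderiv ℝ (f j) (x - z) (EuclideanSpace.single j 1) :=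
      (((hf j).continuous_fderiv one_ne_zero).comp (continuous_const.sub continuous_id)).clm_apply
        continuous_const
    exact ((hQ m).mul hc).integrable_of_hasCompactSupport (hQc m).mul_right

/-- The nonlocal gradient is curl-free. -/
theorem fderiv_nlOp_comm (hn : 1 ≤ n) (hs0 : 0 < s) (hs1 : s < 1) (hδ : 0 < δ)
    (hw : IsCutoff δ w) {f : E n → ℝ} (hf : ContDiff ℝ 2 f) (i j : Fin n) (x : E n) :
    fderiv ℝ (nlOp (gradKernel s w j) f) x (EuclideanSpace.single i 1) =
      fderiv ℝ (nlOp (gradKernel s w i) f) x (EuclideanSpace.single j 1) := by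
  obtain ⟨Q, hQ, hQc, hlim⟩ := exists_potentials hn hs0 hs1 hδ hw
  rw [(isKernel_gradKernel hn hs1 hw j).fderiv_nlOp_apply hf,
    (isKernel_gradKernel hn hs1 hw i).fderiv_nlOp_apply hf]
  have hf' : ContDiff ℝ 1 (fderiv ℝ f) := hf.fderiv_right (by norm_num [one_add_one_eq_two])
  have hd : ∀ v, ContDiff ℝ 1 fun y => fderiv ℝ f y v := fun v => hf'.clm_apply contDiff_const
  have hsymm : ∀ y v v', fderiv ℝ (fun y => fderiv ℝ f y v) y v' =
      fderiv ℝ (fun y => fderiv ℝ f y v') y v := fun y v v' => by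
    rw [fderiv_clm_apply (hf'.differentiable one_ne_zero y) (differentiableAt_const _),
      fderiv_clm_apply (hf'.differentiable one_ne_zero y) (differentiableAt_const _)]
    have := hf.contDiffAt (x := y) |>.isSymmSndFDerivAt (by simp)
    simpa using! this v' v
  refine tendsto_nhds_unique (hlim _ (hd _) j x) ?_
  simp only [hsymm _ (EuclideanSpace.single i 1) (EuclideanSpace.single j 1)]
  exact hlim _ (hd _) i x

/-! ### The nonlocal operators as difference operators -/

theorem nlGrad_apply (hn : 1 ≤ n) (hs1 : s < 1) (hw : IsCutoff δ w) {u : E n → ℝ}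
    (hu : ContDiff ℝ 1 u) (x : E n) (j : Fin n) :
    nlGrad s δ w u x j = cConst n s * nlOp (gradKernel s w j) u x := by
  set G : E n → E n := fun y => ((u x - u y) / ‖x - y‖ *
    (w (x - y) / ‖x - y‖ ^ ((n : ℝ) - 1 + s))) • (‖x - y‖⁻¹ • (x - y)) with hG
  have hGj : ∀ y j, G y j = gradKernel s w j (x - y) • (u x - u y) := fun y j => by
    simp only [hG, gradKernel, PiLp.smul_apply, smul_eq_mul, PiLp.sub_apply]
    ring
  have hball : ∫ y in Metric.ball x δ, G y = ∫ y, G y :=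
    setIntegral_eq_integral_of_forall_compl_eq_zero fun y hy => by
      have : w (x - y) = 0 := hw.eq_zero (by
        rw [← dist_eq_norm, dist_comm]; exact not_lt.1 hy)
      simp [hG, this]
  have hint : ∀ j, Integrable fun y => G y j := fun j => by
    have := ((isKernel_gradKernel hn hs1 hw j).integrable_smul_sub hu x).comp_sub_left x
    simpa only [hGj, sub_sub_cancel] using this
  rw [nlGrad, hball, PiLp.smul_apply, smul_eq_mul, eval_integral_piLp hint]
  simp only [hGj, nlOp]
  rw [← integral_sub_left_eq_self _ _ x]
  simp only [sub_sub_cancel]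

theorem nlDivIntegrand_eq (F : E n → E n) (x y : E n) :
    nlDivIntegrand s w F x y = ∑ j, gradKernel s w j (x - y) • (F x j - F y j) := by
  simp only [nlDivIntegrand, gradKernel, inner_smul_left, inner_smul_right, PiLp.inner_apply,
    Finset.mul_sum, Finset.sum_mul]
  refine Finset.sum_congr rfl fun j _ => ?_
  simp
  ring

theorem integrable_nlDivIntegrand (hn : 1 ≤ n) (hs1 : s < 1) (hw : IsCutoff δ w) {F : E n → E n}
    (hF : ∀ j, ContDiff ℝ 1 fun y => F y j) (x : E n) :
    Integrable (nlDivIntegrand s w F x) := by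
  have : ∀ j, Integrable fun y => gradKernel s w j (x - y) • (F x j - F y j) := fun j => by
    have := ((isKernel_gradKernel hn hs1 hw j).integrable_smul_sub (hF j) x).comp_sub_left x
    simpa only [sub_sub_cancel] using this
  simp only [funext (nlDivIntegrand_eq F x)]
  exact integrable_finsetSum _ fun j _ => this j

theorem nlDiv_eq (hn : 1 ≤ n) (hs1 : s < 1) (hw : IsCutoff δ w) {F : E n → E n}
    (hF : ∀ j, ContDiff ℝ 1 fun y => F y j) (x : E n) :
    nlDiv s δ w F x = cConst n s * ∑ j, nlOp (gradKernel s w j) (fun y => F y j) x := by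
  have hint : ∀ j, Integrable fun y => gradKernel s w j (x - y) • (F x j - F y j) := fun j => by
    have := ((isKernel_gradKernel hn hs1 hw j).integrable_smul_sub (hF j) x).comp_sub_left x
    simpa only [sub_sub_cancel] using this
  rw [nlDiv, setIntegral_eq_integral_of_forall_compl_eq_zero]
  · simp only [nlDivIntegrand_eq]
    rw [integral_finsetSum _ fun j _ => hint j]
    congr 1
    refine Finset.sum_congr rfl fun j _ => ?_
    rw [nlOp, ← integral_sub_left_eq_self _ _ x]
    simp only [sub_sub_cancel]
  · intro y hy
    have : w (x - y) = 0 := hw.eq_zero (by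
      rw [← dist_eq_norm, dist_comm]; exact not_lt.1 hy)
    simp [nlDivIntegrand, this]

end Cutoff

end

/-! ### The classical Piola identity for fields with curl-free rows -/

section

variable {n : ℕ}

theorem cof_apply (A : Matrix (Fin n) (Fin n) ℝ) (i j : Fin n) :
    cof A i j = (A.updateRow i (Pi.single j 1)).det := by
  rw [cof, Matrix.transpose_apply, Matrix.adjugate_apply]

theorem cof_apply_eq_sum_perm (A : Matrix (Fin n) (Fin n) ℝ) (i j : Fin n) :
    cof A i j = ∑ σ : Equiv.Perm (Fin n), ((Equiv.Perm.sign σ : ℤ) : ℝ) *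
      ∏ r, A.updateRow i (Pi.single j 1) r (σ r) := by
  rw [cof_apply, ← Matrix.det_transpose, Matrix.det_apply']
  rfl

/-- An alternating bilinear expression summed against symmetric coefficients vanishes. -/
theorem sum_det_updateRow_updateRow_eq_zero (A : Matrix (Fin n) (Fin n) ℝ) {i k : Fin n}
    (hik : k ≠ i) (S : Fin n → Fin n → ℝ) (hS : ∀ j l, S j l = S l j) :
    ∑ j, ((A.updateRow i (Pi.single j 1)).updateRow k (S j)).det = 0 := by
  set d : Fin n → Fin n → ℝ := fun j l =>
    ((A.updateRow i (Pi.single j 1)).updateRow k (Pi.single l 1)).det with hd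
  have hanti : ∀ j l, d j l = -d l j := fun j l => by
    rw [hd]
    dsimp only
    refine Eq.trans ?_ ((Matrix.detRowAlternating (R := ℝ)).map_swap
      ((A.updateRow i (Pi.single l 1)).updateRow k (Pi.single j 1)) hik)
    refine congrArg Matrix.det (Matrix.ext fun r c => ?_)
    change _ = (A.updateRow i (Pi.single l 1)).updateRow k (Pi.single j 1) (Equiv.swap k i r) c
    rcases eq_or_ne r k with rfl | hk
    · simp [Matrix.updateRow_ne hik.symm]
    · rcases eq_or_ne r i with rfl | hi
      · simp [Matrix.updateRow_ne hk]
      · rw [Equiv.swap_apply_of_ne_of_ne hk hi]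
        simp [Matrix.updateRow_ne hk, Matrix.updateRow_ne hi]
  have hexp : ∀ j, ((A.updateRow i (Pi.single j 1)).updateRow k (S j)).det =
      ∑ l, S j l * d j l := fun j => by
    conv_lhs => rw [pi_eq_sum_univ' (S j)]
    refine ((Matrix.detRowAlternating (R := ℝ)).map_update_sum Finset.univ k _ _).trans ?_
    exact Finset.sum_congr rfl fun l _ => Matrix.det_updateRow_smul _ _ _ _
  simp only [hexp]
  have hswap : ∑ j, ∑ l, S j l * d j l = -∑ j, ∑ l, S j l * d j l := by
    conv_lhs => rw [Finset.sum_comm]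
    simp only [← Finset.sum_neg_distrib]
    refine Finset.sum_congr rfl fun j _ => Finset.sum_congr rfl fun l _ => ?_
    rw [hS l j, hanti l j]
    ring
  linarith

/-- The determinant as a continuous multilinear map of the rows. -/
noncomputable def detCMM (n : ℕ) : ContinuousMultilinearMap ℝ (fun _ : Fin n => Fin n → ℝ) ℝ :=
  { (Matrix.detRowAlternating (n := Fin n) (R := ℝ)).toMultilinearMap with
    cont := (continuous_id (X := Matrix (Fin n) (Fin n) ℝ)).matrix_det }

theorem contDiff_cof {A : E n → Matrix (Fin n) (Fin n) ℝ} {m : WithTop ℕ∞}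
    (hA : ∀ i j, ContDiff ℝ m fun x => A x i j) (i j : Fin n) :
    ContDiff ℝ m fun x => cof (A x) i j := by
  simp only [cof_apply_eq_sum_perm]
  refine ContDiff.sum fun σ _ => contDiff_const.mul (contDiff_prod fun r _ => ?_)
  rcases eq_or_ne r i with rfl | hr
  · simpa only [Matrix.updateRow_self] using contDiff_const
  · simpa only [Matrix.updateRow_ne hr] using hA r (σ r)

/-- The cofactor matrix of a `C¹` matrix field whose rows are curl-free is divergence-free. -/
theorem sum_fderiv_cof_eq_zero {A : E n → Matrix (Fin n) (Fin n) ℝ}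
    (hA : ∀ i j, ContDiff ℝ 1 fun x => A x i j)
    (hcurl : ∀ x k j l, fderiv ℝ (fun y => A y k l) x (EuclideanSpace.single j 1) =
      fderiv ℝ (fun y => A y k j) x (EuclideanSpace.single l 1)) (i : Fin n) (x : E n) :
    ∑ j, fderiv ℝ (fun y => cof (A y) i j) x (EuclideanSpace.single j 1) = 0 := by
  have hd : ∀ j k, HasFDerivAt (fun y => (A y).updateRow i (Pi.single j 1) k)
      (if k = i then 0 else ContinuousLinearMap.pi fun l => fderiv ℝ (fun y => A y k l) x) x := by
    intro j k
    by_cases hk : k = i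
    · subst hk
      simpa using! hasFDerivAt_const (𝕜 := ℝ) (Pi.single j (1 : ℝ) : Fin n → ℝ) x
    · simp only [hk, if_false, Matrix.updateRow_ne hk]
      exact hasFDerivAt_pi.2 fun l => ((hA k l).differentiable one_ne_zero x).hasFDerivAt
  have hcof : ∀ j, fderiv ℝ (fun y => cof (A y) i j) x (EuclideanSpace.single j 1) =
      ∑ k, if k = i then 0 else (((A x).updateRow i (Pi.single j 1)).updateRow k
        fun l => fderiv ℝ (fun y => A y k l) x (EuclideanSpace.single j 1)).det := fun j => by
    have h := HasFDerivAt.multilinear_comp (f := detCMM n) (hd j)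
    have e : (fun y => cof (A y) i j) =
        fun y => detCMM n fun k => (A y).updateRow i (Pi.single j 1) k :=
      funext fun y => cof_apply _ _ _
    rw [e, h.fderiv, sum_apply]
    refine Finset.sum_congr rfl fun k _ => ?_
    rw [ContinuousLinearMap.comp_apply]
    by_cases hk : k = i
    · simpa [hk] using! (detCMM n).map_coord_zero (m := Function.update _ k 0) k (by simp)
    · simp only [hk, if_false]
      rfl
  simp only [hcof]
  rw [Finset.sum_comm]
  refine Finset.sum_eq_zero fun k _ => ?_
  by_cases hk : k = i
  · simp [hk]
  · simp only [hk, if_false]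
    exact sum_det_updateRow_updateRow_eq_zero (A x) hk
      (fun j l => fderiv ℝ (fun y => A y k l) x (EuclideanSpace.single j 1)) fun j l => hcurl x k j l

end

/-! ### Products and cofactors of sequences converging in `L^p` -/

section

variable {n : ℕ}

open scoped ENNReal

/-- The sequence `f` of functions in `L^p(μ)` converges to `g` in `L^p(μ)`. -/
structure TendstoLp {α : Type*} [MeasurableSpace α] (μ : Measure α) (p : ℝ≥0∞) (f : ℕ → α → ℝ)
    (g : α → ℝ) : Prop where
  memLp : ∀ k, MemLp (f k) p μ
  memLp_lim : MemLp g p μ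
  tendsto : Tendsto (fun k => eLpNorm (f k - g) p μ) atTop (𝓝 0)

namespace TendstoLp

variable {α : Type*} [MeasurableSpace α] {μ : Measure α} {p q r : ℝ≥0∞} {f f' : ℕ → α → ℝ}
  {g g' : α → ℝ}

theorem const (hg : MemLp g p μ) : TendstoLp μ p (fun _ => g) g :=
  ⟨fun _ => hg, hg, by simp⟩

theorem mono_exponent [IsFiniteMeasure μ] (h : TendstoLp μ q f g) (hpq : p ≤ q) (hp : p ≠ 0) :
    TendstoLp μ p f g := by
  refine ⟨fun k => (h.memLp k).mono_exponent hpq, h.memLp_lim.mono_exponent hpq, ?_⟩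
  have hexp : 0 ≤ 1 / p.toReal - 1 / q.toReal := by
    rcases eq_or_ne q ∞ with rfl | hq
    · simp
    · have hp' : 0 < p.toReal := ENNReal.toReal_pos hp (ne_top_of_le_ne_top hq hpq)
      exact sub_nonneg.2 (one_div_le_one_div_of_le hp' (ENNReal.toReal_mono hq hpq))
  have h0 := ENNReal.Tendsto.mul_const (b := μ Set.univ ^ (1 / p.toReal - 1 / q.toReal)) h.tendsto
    (Or.inr (ENNReal.rpow_ne_top_of_nonneg hexp (measure_ne_top _ _)))
  rw [zero_mul] at h0
  exact tendsto_of_tendsto_of_tendsto_of_le_of_le tendsto_const_nhds h0 (fun _ => zero_le)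
    fun k => eLpNorm_le_eLpNorm_mul_rpow_measure_univ hpq
      ((h.memLp k).sub h.memLp_lim).aestronglyMeasurable

theorem add (h : TendstoLp μ p f g) (h' : TendstoLp μ p f' g') (hp : 1 ≤ p) :
    TendstoLp μ p (fun k => f k + f' k) (g + g') := by
  refine ⟨fun k => (h.memLp k).add (h'.memLp k), h.memLp_lim.add h'.memLp_lim, ?_⟩
  have h0 := h.tendsto.add h'.tendsto
  rw [add_zero] at h0
  refine tendsto_of_tendsto_of_tendsto_of_le_of_le tendsto_const_nhds h0 (fun _ => zero_le)
    fun k => ?_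
  rw [show f k + f' k - (g + g') = (f k - g) + (f' k - g') by ring]
  exact eLpNorm_add_le ((h.memLp k).sub h.memLp_lim).aestronglyMeasurable
    ((h'.memLp k).sub h'.memLp_lim).aestronglyMeasurable hp

theorem mul [hpqr : ENNReal.HolderTriple p q r] (h : TendstoLp μ p f g) (h' : TendstoLp μ q f' g')
    (hq : 1 ≤ q) (hr : 1 ≤ r) : TendstoLp μ r (fun k => f k * f' k) (g * g') := by
  refine ⟨fun k => (h'.memLp k).mul (h.memLp k), h'.memLp_lim.mul h.memLp_lim, ?_⟩
  have hbound : Tendsto (fun k => eLpNorm (f k - g) p μ *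
      (eLpNorm (f' k - g') q μ + eLpNorm g' q μ) + eLpNorm g p μ * eLpNorm (f' k - g') q μ) atTop
      (𝓝 (0 * (0 + eLpNorm g' q μ) + eLpNorm g p μ * 0)) := by
    refine (ENNReal.Tendsto.mul h.tendsto (Or.inr ?_) (h'.tendsto.add_const _) (Or.inr ?_)).add
      (ENNReal.Tendsto.const_mul h'.tendsto (Or.inr h.memLp_lim.eLpNorm_ne_top))
    · simpa using h'.memLp_lim.eLpNorm_ne_top
    · simp
  rw [zero_mul, mul_zero, add_zero] at hbound
  refine tendsto_of_tendsto_of_tendsto_of_le_of_le tendsto_const_nhds hbound (fun _ => zero_le)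
    fun k => ?_
  have hd := (h.memLp k).sub h.memLp_lim
  have hd' := (h'.memLp k).sub h'.memLp_lim
  rw [show f k * f' k - g * g' = (f k - g) • f' k + g • (f' k - g') by
    simp only [smul_eq_mul]; ring]
  refine (eLpNorm_add_le (hd.1.smul (h'.memLp k).1) (h.memLp_lim.1.smul hd'.1) hr).trans ?_
  gcongr
  · refine (eLpNorm_smul_le_mul_eLpNorm (p := p) (q := q) (h'.memLp k).1 hd.1).trans ?_
    gcongr
    conv_lhs => rw [show f' k = (f' k - g') + g' by ring]
    exact eLpNorm_add_le hd'.1 h'.memLp_lim.1 hq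
  · exact eLpNorm_smul_le_mul_eLpNorm hd'.1 h.memLp_lim.1

theorem const_mul (h : TendstoLp μ p f g) (hp : 1 ≤ p) {φ : α → ℝ} (hφ : MemLp φ ∞ μ) :
    TendstoLp μ p (fun k => φ * f k) (φ * g) :=
  (const hφ).mul h hp hp

theorem prod {ι : Type*} (t : Finset ι) {P : ι → ℝ≥0∞} {F : ι → ℕ → α → ℝ} {G : ι → α → ℝ}
    (hP : ∑ i ∈ t, (P i)⁻¹ ≤ 1) (h : ∀ i ∈ t, TendstoLp μ (P i) (F i) (G i)) :
    TendstoLp μ (∑ i ∈ t, (P i)⁻¹)⁻¹ (fun k => ∏ i ∈ t, F i k) (∏ i ∈ t, G i) := by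
  classical
  induction t using Finset.induction_on with
  | empty =>
    simp only [Finset.prod_empty]
    refine const ?_
    rw [Finset.sum_empty, ENNReal.inv_zero]
    exact memLp_top_const (1 : ℝ)
  | insert i t hi ih =>
    have hP' : ∑ i ∈ t, (P i)⁻¹ ≤ 1 :=
      (Finset.sum_le_sum_of_subset (Finset.subset_insert i t)).trans hP
    have := ih hP' fun j hj => h j (Finset.mem_insert_of_mem hj)
    simp only [Finset.prod_insert hi]
    have : ENNReal.HolderTriple (P i) (∑ i ∈ t, (P i)⁻¹)⁻¹ (∑ i ∈ insert i t, (P i)⁻¹)⁻¹ :=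
      ⟨by simp [Finset.sum_insert hi]⟩
    exact (h i (Finset.mem_insert_self i t)).mul ‹_› (ENNReal.one_le_inv.2 hP')
      (ENNReal.one_le_inv.2 hP)

theorem sum {ι : Type*} (t : Finset ι) {F : ι → ℕ → α → ℝ} {G : ι → α → ℝ} (hp : 1 ≤ p)
    (h : ∀ i ∈ t, TendstoLp μ p (F i) (G i)) :
    TendstoLp μ p (fun k => ∑ i ∈ t, F i k) (∑ i ∈ t, G i) := by
  classical
  induction t using Finset.induction_on with
  | empty => simpa using const (MemLp.zero (p := p) (μ := μ) (ε := ℝ))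
  | insert i t hi ih =>
    simp only [Finset.sum_insert hi]
    exact (h i (Finset.mem_insert_self i t)).add
      (ih fun j hj => h j (Finset.mem_insert_of_mem hj)) hp

theorem tendsto_integral (h : TendstoLp μ 1 f g) :
    Tendsto (fun k => ∫ x, f k x ∂μ) atTop (𝓝 (∫ x, g x ∂μ)) :=
  tendsto_integral_of_L1' g h.memLp_lim.1
    (Eventually.of_forall fun k => memLp_one_iff_integrable.1 (h.memLp k)) h.tendsto

/-- If the entries of `A k` converge to those of `B` in `L^p` with `p ≥ n - 1`, then the
cofactors, being sums of products of `n - 1` entries, converge in `L¹`. -/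
theorem cof [IsFiniteMeasure μ] {p : ℝ} (hp : (n : ℝ) - 1 ≤ p)
    {A : ℕ → α → Matrix (Fin n) (Fin n) ℝ} {B : α → Matrix (Fin n) (Fin n) ℝ}
    (h : ∀ i j, TendstoLp μ (ENNReal.ofReal p) (fun k x => A k x i j) fun x => B x i j)
    (i j : Fin n) :
    TendstoLp μ 1 (fun k x => cof (A k x) i j) fun x => cof (B x) i j := by
  -- the row `i` is replaced by a constant one, to which the exponent `∞` is attached
  set P : Fin n → ℝ≥0∞ := fun r => if r = i then ∞ else ENNReal.ofReal p with hPdef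
  have hn : 1 ≤ n := Fin.pos i
  have hP : ∑ r, (P r)⁻¹ ≤ 1 := by
    rw [← Finset.add_sum_erase _ _ (Finset.mem_univ i),
      Finset.sum_congr rfl (g := fun _ => (ENNReal.ofReal p)⁻¹) fun r hr => by
        simp [hPdef, Finset.ne_of_mem_erase hr]]
    simp only [hPdef, if_true, ENNReal.inv_top, zero_add, Finset.sum_const, nsmul_eq_mul,
      Finset.card_erase_of_mem (Finset.mem_univ i), Finset.card_univ, Fintype.card_fin]
    rw [← div_eq_mul_inv]
    refine ENNReal.div_le_of_le_mul ?_
    rw [one_mul, ← ENNReal.ofReal_natCast, Nat.cast_sub hn, Nat.cast_one]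
    exact ENNReal.ofReal_le_ofReal hp
  have hone : (1 : ℝ≥0∞) ≤ (∑ r, (P r)⁻¹)⁻¹ := ENNReal.one_le_inv.2 hP
  have hterm : ∀ σ : Equiv.Perm (Fin n), TendstoLp μ 1
      (fun k => (fun _ => ((Equiv.Perm.sign σ : ℤ) : ℝ)) *
        ∏ r, fun x => (A k x).updateRow i (Pi.single j 1) r (σ r))
      ((fun _ => ((Equiv.Perm.sign σ : ℤ) : ℝ)) *
        ∏ r, fun x => (B x).updateRow i (Pi.single j 1) r (σ r)) := fun σ => by
    refine const_mul ?_ le_rfl (memLp_top_const _)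
    refine (TendstoLp.prod Finset.univ (P := P)
      (F := fun r k x => (A k x).updateRow i (Pi.single j 1) r (σ r))
      (G := fun r x => (B x).updateRow i (Pi.single j 1) r (σ r)) hP
      fun r _ => ?_).mono_exponent hone one_ne_zero
    by_cases hr : r = i
    · subst hr
      simp only [hPdef, if_true, Matrix.updateRow_self]
      exact const (memLp_top_const _)
    · simp only [hPdef, hr, if_false, Matrix.updateRow_ne hr]
      exact h r (σ r)
  have e : ∀ C : α → Matrix (Fin n) (Fin n) ℝ, (fun x => NonlocalPiola.cof (C x) i j) =
      ∑ σ : Equiv.Perm (Fin n), (fun _ => ((Equiv.Perm.sign σ : ℤ) : ℝ)) *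
        ∏ r, fun x => (C x).updateRow i (Pi.single j 1) r (σ r) := fun C => by
    funext x
    simp [cof_apply_eq_sum_perm]
  rw [show (fun k x => NonlocalPiola.cof (A k x) i j) = _ from funext fun k => e (A k), e B]
  exact TendstoLp.sum Finset.univ le_rfl fun σ _ => hterm σ

end TendstoLp

end

/-! ### The nonlocal gradient of smooth functions -/

section

variable {n : ℕ} {s δ : ℝ} {w : E n → ℝ}

theorem continuous_nlGrad (hn : 1 ≤ n) (hs1 : s < 1) (hw : IsCutoff δ w) {u : E n → ℝ}
    (hu : ContDiff ℝ 1 u) : Continuous (nlGrad s δ w u) := by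
  have h : Continuous fun x => (nlGrad s δ w u x).ofLp := by
    refine continuous_pi fun j => ?_
    simp only [nlGrad_apply hn hs1 hw hu]
    exact continuous_const.mul ((isKernel_gradKernel hn hs1 hw j).continuous_nlOp hu)
  exact (PiLp.continuous_toLp 2 _).comp h

theorem nlGrad_eq_zero (hn : 1 ≤ n) (hs1 : s < 1) (hδ : 0 < δ) (hw : IsCutoff δ w) {u : E n → ℝ}
    (hu : ContDiff ℝ 1 u) {x : E n} (hx : ∀ y, dist x y < δ → u y = 0) :
    nlGrad s δ w u x = 0 := by
  ext j
  rw [nlGrad_apply hn hs1 hw hu, (isKernel_gradKernel hn hs1 hw j).nlOp_eq_zero hδ hx]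
  simp

theorem nlGrad_eq_zero_of_notMem_outset (hn : 1 ≤ n) (hs1 : s < 1) (hδ : 0 < δ)
    (hw : IsCutoff δ w) {Ω : Set (E n)} {φ : E n → ℝ} (hφ : IsTest Ω φ) {x : E n}
    (hx : x ∉ outset δ Ω) : nlGrad s δ w φ x = 0 :=
  nlGrad_eq_zero hn hs1 hδ hw (hφ.1.of_le (mod_cast le_top)) fun y hy =>
    image_eq_zero_of_notMem_tsupport fun h =>
      hx (Metric.mem_thickening_iff.2 ⟨y, hφ.2.2 h, hy⟩)

/-- A point of `Ω_{-δ}` has distance at least `δ` to the complement of `Ω`, because a segment that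
leaves `Ω` meets its frontier. -/
theorem mem_of_dist_lt_of_mem_inset {Ω : Set (E n)} {x y : E n} (hy : y ∈ inset δ Ω)
    (hxy : dist x y < δ) : x ∈ Ω := by
  by_contra hx
  obtain ⟨z, hz, hd⟩ := exists_mem_frontier_infDist_compl_eq_dist hy.1
    (fun h => hx (h ▸ Set.mem_univ x) : Ω ≠ Set.univ)
  have h1 := Metric.infDist_le_dist_of_mem (x := y) hz
  have h2 := Metric.infDist_le_dist_of_mem (x := y) (s := Ωᶜ) hx
  rw [dist_comm] at h2
  exact absurd hy.2 (by linarith)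

theorem nlGrad_eq_zero_of_notMem (hn : 1 ≤ n) (hs1 : s < 1) (hδ : 0 < δ)
    (hw : IsCutoff δ w) {Ω : Set (E n)} {φ : E n → ℝ} (hφ : IsTest (inset δ Ω) φ) {x : E n}
    (hx : x ∉ Ω) : nlGrad s δ w φ x = 0 :=
  nlGrad_eq_zero hn hs1 hδ hw (hφ.1.of_le (mod_cast le_top)) fun _ hy =>
    image_eq_zero_of_notMem_tsupport fun h =>
      hx (mem_of_dist_lt_of_mem_inset (hφ.2.2 h) hy)

theorem contDiff_nlGradMat (hn : 1 ≤ n) (hs1 : s < 1) (hw : IsCutoff δ w) {u : E n → E n}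
    (hu : ContDiff ℝ 2 u) (i j : Fin n) : ContDiff ℝ 1 fun x => nlGradMat s δ w u x i j := by
  have hui : ContDiff ℝ 2 fun z => u z i := contDiff_euclidean.1 hu i
  simp only [nlGradMat, Matrix.of_apply, nlGrad_apply hn hs1 hw (hui.of_le one_le_two)]
  exact contDiff_const.mul ((isKernel_gradKernel hn hs1 hw j).contDiff_nlOp hui)

theorem sum_fderiv_cof_nlGradMat (hn : 1 ≤ n) (hs0 : 0 < s) (hs1 : s < 1) (hδ : 0 < δ)
    (hw : IsCutoff δ w) {u : E n → E n} (hu : ContDiff ℝ 2 u) (i : Fin n) (x : E n) :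
    ∑ j, fderiv ℝ (fun z => cof (nlGradMat s δ w u z) i j) x (EuclideanSpace.single j 1) = 0 := by
  refine sum_fderiv_cof_eq_zero (contDiff_nlGradMat hn hs1 hw hu) (fun x k j l => ?_) i x
  have huk : ContDiff ℝ 2 fun z => u z k := contDiff_euclidean.1 hu k
  have hd : ∀ j, DifferentiableAt ℝ (nlOp (gradKernel s w j) fun z => u z k) x := fun j =>
    ((isKernel_gradKernel hn hs1 hw j).contDiff_nlOp huk).differentiable one_ne_zero x
  simp only [nlGradMat, Matrix.of_apply, nlGrad_apply hn hs1 hw (huk.of_le one_le_two)]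
  rw [fderiv_const_mul (hd l), fderiv_const_mul (hd j)]
  simp only [smul_apply, fderiv_nlOp_comm hn hs0 hs1 hδ hw huk j l]

theorem fderiv_coord {u : E n → E n} (hu : Differentiable ℝ u) (i : Fin n) (x v : E n) :
    fderiv ℝ (fun z => u z i) x v = fderiv ℝ u x v i := by
  have h := (EuclideanSpace.proj (𝕜 := ℝ) i).hasFDerivAt.comp x (hu x).hasFDerivAt
  exact congrArg (fun L => L v) h.fderiv

theorem contDiff_jacobian {u : E n → E n} (hu : ContDiff ℝ 2 u) (i j : Fin n) :
    ContDiff ℝ 1 fun x => jacobian u x i j := by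
  have h : ContDiff ℝ 1 fun x => fderiv ℝ u x (EuclideanSpace.single j 1) :=
    (hu.fderiv_right (by norm_num [one_add_one_eq_two])).clm_apply contDiff_const
  exact contDiff_euclidean.1 h i

theorem sum_fderiv_cof_jacobian {u : E n → E n} (hu : ContDiff ℝ 2 u) (i : Fin n) (x : E n) :
    ∑ j, fderiv ℝ (fun z => cof (jacobian u z) i j) x (EuclideanSpace.single j 1) = 0 := by
  refine sum_fderiv_cof_eq_zero (contDiff_jacobian hu) (fun x k j l => ?_) i x
  have hu' : ContDiff ℝ 1 (fderiv ℝ u) := hu.fderiv_right (by norm_num [one_add_one_eq_two])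
  have hd := hu'.differentiable one_ne_zero
  have h : ∀ v v', fderiv ℝ (fun y => fderiv ℝ u y v k) x v' = fderiv ℝ (fderiv ℝ u) x v' v k :=
    fun v v' => by
      rw [fderiv_coord (u := fun y => fderiv ℝ u y v)
        (hd.clm_apply (differentiable_const v)),
        fderiv_clm_apply (hd x) (differentiableAt_const _)]
      simp
  simp only [jacobian, Matrix.of_apply, h]
  rw [(hu.contDiffAt (x := x)).isSymmSndFDerivAt (by simp)
    (EuclideanSpace.single j 1) (EuclideanSpace.single l 1)]

theorem nlDivMat_eq_zero (hn : 1 ≤ n) (hs0 : 0 < s) (hs1 : s < 1) (hδ : 0 < δ)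
    (hw : IsCutoff δ w) {M : E n → Matrix (Fin n) (Fin n) ℝ}
    (hM : ∀ i j, ContDiff ℝ 1 fun x => M x i j)
    (hdiv : ∀ i x, ∑ j, fderiv ℝ (fun z => M z i j) x (EuclideanSpace.single j 1) = 0)
    (x : E n) : nlDivMat s δ w M x = 0 := by
  funext i
  rw [nlDivMat, nlDiv_eq hn hs1 hw (F := row M i) (hM i)]
  rw [sum_nlOp_eq_zero_of_div_eq_zero hn hs0 hs1 hδ hw (f := fun j y => row M i y j)
    (hM i) (hdiv i), mul_zero]
  rfl

/-! ### Orthogonality of divergence-free fields to gradients -/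

theorem gradient_apply {φ : E n → ℝ} (x : E n) (j : Fin n) :
    gradient φ x j = fderiv ℝ φ x (EuclideanSpace.single j 1) := by
  rw [← inner_gradient_left, EuclideanSpace.inner_single_right]
  simp

theorem integral_sum_mul_gradient_eq_zero {f : Fin n → E n → ℝ} (hf : ∀ j, ContDiff ℝ 1 (f j))
    (hdiv : ∀ x, ∑ j, fderiv ℝ (f j) x (EuclideanSpace.single j 1) = 0) {φ : E n → ℝ}
    (hφ : ContDiff ℝ 1 φ) (hφc : HasCompactSupport φ) :
    ∫ x, ∑ j, f j x * gradient φ x j = 0 := by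
  have hφ' : ∀ v, Continuous fun x => fderiv ℝ φ x v := fun v =>
    (hφ.continuous_fderiv one_ne_zero).clm_apply continuous_const
  have hf' : ∀ j v, Continuous fun x => fderiv ℝ (f j) x v := fun j v =>
    ((hf j).continuous_fderiv one_ne_zero).clm_apply continuous_const
  have hi : ∀ j, Integrable fun x => f j x * fderiv ℝ φ x (EuclideanSpace.single j 1) := fun j =>
    ((hf j).continuous.mul (hφ' _)).integrable_of_hasCompactSupport (hφc.fderiv_apply ℝ _).mul_left
  have hi' : ∀ j, Integrable fun x => fderiv ℝ (f j) x (EuclideanSpace.single j 1) * φ x :=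
    fun j => ((hf' j _).mul hφ.continuous).integrable_of_hasCompactSupport hφc.mul_left
  simp only [gradient_apply]
  rw [integral_finsetSum _ fun j _ => hi j]
  have : ∀ j, ∫ x, f j x * fderiv ℝ φ x (EuclideanSpace.single j 1) =
      -∫ x, fderiv ℝ (f j) x (EuclideanSpace.single j 1) * φ x := fun j =>
    integral_mul_fderiv_eq_neg_fderiv_mul_of_integrable (hi' j) (hi j)
      (((hf j).continuous.mul hφ.continuous).integrable_of_hasCompactSupport hφc.mul_left)
      (fun x _ => (hf j).differentiable one_ne_zero x) (fun x _ => hφ.differentiable one_ne_zero x)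
  simp only [this, Finset.sum_neg_distrib]
  rw [← integral_finsetSum _ fun j _ => hi' j]
  simp [← Finset.sum_mul, hdiv]

theorem integrable_mul_nlOp_gradKernel (hn : 1 ≤ n) (hs1 : s < 1) (hδ : 0 < δ)
    (hw : IsCutoff δ w) {f φ : E n → ℝ} (hf : Continuous f) (hφ : ContDiff ℝ 1 φ)
    (hφc : HasCompactSupport φ) (j : Fin n) :
    Integrable fun x => f x * nlOp (gradKernel s w j) φ x := by
  have hk := isKernel_gradKernel hn hs1 hw j
  refine (hf.mul (hk.continuous_nlOp hφ)).integrable_of_hasCompactSupport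
    (HasCompactSupport.mul_left ?_)
  refine HasCompactSupport.of_support_subset_isCompact
    (hφc.isCompact.cthickening (r := δ)) fun x hx => ?_
  by_contra h
  refine hx (hk.nlOp_eq_zero hδ fun y hy => image_eq_zero_of_notMem_tsupport fun hy' => h ?_)
  exact Metric.mem_cthickening_of_dist_le x y δ _ hy' hy.le

theorem integral_nlOp_gradKernel_mul (hn : 1 ≤ n) (hs1 : s < 1) (hw : IsCutoff δ w)
    {v φ : E n → ℝ} (hv : ContDiff ℝ 1 v) (hφ : ContDiff ℝ 1 φ) (hφc : HasCompactSupport φ)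
    (j : Fin n) :
    ∫ x, nlOp (gradKernel s w j) v x * φ x = -∫ x, v x * nlOp (gradKernel s w j) φ x :=
  (isKernel_gradKernel hn hs1 hw j).integral_nlOp_mul (gradKernel_neg hw j) hv hφ hφc

theorem integral_sum_mul_nlGrad_eq_zero (hn : 1 ≤ n) (hs0 : 0 < s) (hs1 : s < 1) (hδ : 0 < δ)
    (hw : IsCutoff δ w) {f : Fin n → E n → ℝ} (hf : ∀ j, ContDiff ℝ 1 (f j))
    (hdiv : ∀ x, ∑ j, fderiv ℝ (f j) x (EuclideanSpace.single j 1) = 0) {φ : E n → ℝ}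
    (hφ : ContDiff ℝ 1 φ) (hφc : HasCompactSupport φ) :
    ∫ x, ∑ j, f j x * nlGrad s δ w φ x j = 0 := by
  have h1 : ∀ x, ∑ j, f j x * nlGrad s δ w φ x j =
      cConst n s * ∑ j, f j x * nlOp (gradKernel s w j) φ x := fun x => by
    rw [Finset.mul_sum]
    refine Finset.sum_congr rfl fun j _ => ?_
    rw [nlGrad_apply hn hs1 hw hφ]
    ring
  have hi : ∀ j, Integrable fun x => nlOp (gradKernel s w j) (f j) x * φ x := fun j =>
    (((isKernel_gradKernel hn hs1 hw j).continuous_nlOp (hf j)).mul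
      hφ.continuous).integrable_of_hasCompactSupport hφc.mul_left
  have h2 : ∀ j, ∫ x, f j x * nlOp (gradKernel s w j) φ x =
      -∫ x, nlOp (gradKernel s w j) (f j) x * φ x := fun j => by
    rw [integral_nlOp_gradKernel_mul hn hs1 hw (hf j) hφ hφc, neg_neg]
  simp only [h1]
  rw [integral_const_mul, integral_finsetSum _ fun j _ =>
    integrable_mul_nlOp_gradKernel hn hs1 hδ hw (hf j).continuous hφ hφc j]
  simp only [h2, Finset.sum_neg_distrib]
  rw [← integral_finsetSum _ fun j _ => hi j]
  simp [← Finset.sum_mul, sum_nlOp_eq_zero_of_div_eq_zero hn hs0 hs1 hδ hw hf hdiv]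

end

/-! ### The nonlocal gradient as a limit of smooth ones -/

section

variable {n : ℕ} {s δ : ℝ} {w : E n → ℝ}

theorem memLp_restrict_of_continuous {Ω : Set (E n)} (hΩ : Bornology.IsBounded Ω) {f : E n → ℝ}
    (hf : Continuous f) (p : ENNReal) : MemLp f p (volume.restrict Ω) := by
  obtain ⟨C, hC⟩ := hΩ.isCompact_closure.exists_bound_of_continuousOn hf.continuousOn
  exact MemLp.mono_measure (Measure.restrict_mono subset_closure le_rfl) <| by
    have : IsFiniteMeasure (volume.restrict (closure Ω)) :=
      ⟨by simpa using hΩ.isCompact_closure.measure_lt_top⟩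
    exact MemLp.of_bound hf.aestronglyMeasurable C
      ((ae_restrict_iff' isClosed_closure.measurableSet).2 (ae_of_all _ hC))

theorem IsGradLimit.exists_tendstoLp (hn : 1 ≤ n) (hs1 : s < 1) (hw : IsCutoff δ w)
    {Ω : Set (E n)} (hΩ : Bornology.IsBounded Ω) {p : ℝ} {u : E n → ℝ} {U : E n → E n}
    (h : IsGradLimit s δ w Ω p u U) :
    ∃ v : ℕ → E n → ℝ, (∀ k, IsTest Set.univ (v k)) ∧
      TendstoLp (volume.restrict (outset δ Ω)) (ENNReal.ofReal p) v u ∧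
      ∀ j, TendstoLp (volume.restrict Ω) (ENNReal.ofReal p) (fun k x => nlGrad s δ w (v k) x j)
        fun x => U x j := by
  obtain ⟨hu, hU, v, hv, hlim, hlim'⟩ := h
  have hΩ' : Bornology.IsBounded (outset δ Ω) := hΩ.thickening
  refine ⟨v, hv, ⟨fun k => memLp_restrict_of_continuous hΩ' (hv k).1.continuous _, hu, hlim⟩,
    fun j => ⟨fun k => memLp_restrict_of_continuous hΩ ?_ _, ?_, ?_⟩⟩
  · exact (EuclideanSpace.proj (𝕜 := ℝ) j).continuous.comp
      (continuous_nlGrad hn hs1 hw ((hv k).1.of_le (mod_cast le_top)))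
  · exact hU.eval_piLp j
  · refine tendsto_of_tendsto_of_tendsto_of_le_of_le tendsto_const_nhds hlim' (fun _ => zero_le)
      fun k => eLpNorm_mono fun x => ?_
    exact PiLp.norm_apply_le (nlGrad s δ w (v k) x - U x) j

/-- The nonlocal gradient in the sense of limits of smooth functions satisfies the nonlocal
integration by parts formula; in particular it is a weak nonlocal gradient. -/
theorem IsGradLimit.integral_mul_test (hn : 1 ≤ n) (hs1 : s < 1) (hδ : 0 < δ) (hw : IsCutoff δ w)
    {Ω : Set (E n)} (hΩ : Bornology.IsBounded Ω) {p : ℝ} (hp : 1 ≤ p) {u : E n → ℝ}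
    {U : E n → E n} (h : IsGradLimit s δ w Ω p u U) {φ : E n → ℝ} (hφ : IsTest Ω φ) (j : Fin n) :
    ∫ x in Ω, φ x * U x j = -∫ x in outset δ Ω, nlGrad s δ w φ x j * u x := by
  obtain ⟨v, hv, hvu, hvU⟩ := h.exists_tendstoLp hn hs1 hw hΩ
  have hp' : (1 : ENNReal) ≤ ENNReal.ofReal p := by simpa using hp
  have hΩ' : Bornology.IsBounded (outset δ Ω) := hΩ.thickening
  have : IsFiniteMeasure (volume.restrict Ω) := ⟨by simpa using hΩ.measure_lt_top⟩
  have : IsFiniteMeasure (volume.restrict (outset δ Ω)) := ⟨by simpa using hΩ'.measure_lt_top⟩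
  have hφ1 : ContDiff ℝ 1 φ := hφ.1.of_le (mod_cast le_top)
  have hφj : Continuous fun x => nlGrad s δ w φ x j :=
    (EuclideanSpace.proj (𝕜 := ℝ) j).continuous.comp (continuous_nlGrad hn hs1 hw hφ1)
  have h1 := (((hvU j).mono_exponent hp' one_ne_zero).const_mul le_rfl
    (memLp_restrict_of_continuous hΩ hφ.1.continuous _)).tendsto_integral
  have h2 := ((hvu.mono_exponent hp' one_ne_zero).const_mul le_rfl
    (memLp_restrict_of_continuous hΩ' hφj _)).tendsto_integral.neg
  refine tendsto_nhds_unique h1 (h2.congr fun k => ?_)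
  have hv1 : ContDiff ℝ 1 (v k) := (hv k).1.of_le (mod_cast le_top)
  simp only [Pi.mul_apply]
  rw [setIntegral_eq_integral_of_forall_compl_eq_zero (s := Ω) fun x hx => by
      rw [image_eq_zero_of_notMem_tsupport fun h => hx (hφ.2.2 h), zero_mul],
    setIntegral_eq_integral_of_forall_compl_eq_zero (s := outset δ Ω) fun x hx => by
      rw [nlGrad_eq_zero_of_notMem_outset hn hs1 hδ hw hφ hx]; simp]
  have e1 : ∀ x, φ x * nlGrad s δ w (v k) x j =
      cConst n s * (nlOp (gradKernel s w j) (v k) x * φ x) := fun x => by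
    rw [nlGrad_apply hn hs1 hw hv1]; ring
  have e2 : ∀ x, nlGrad s δ w φ x j * v k x =
      cConst n s * (v k x * nlOp (gradKernel s w j) φ x) := fun x => by
    rw [nlGrad_apply hn hs1 hw hφ1]; ring
  simp only [e1, e2, integral_const_mul]
  rw [integral_nlOp_gradKernel_mul hn hs1 hw hv1 hφ1 hφ.2.1]
  ring

/-- The nonlocal gradient does not depend on the approximating sequence nor on the exponent. -/
theorem IsGradLimit.ae_eq (hn : 1 ≤ n) (hs1 : s < 1) (hδ : 0 < δ) (hw : IsCutoff δ w)
    {Ω : Set (E n)} (hΩo : IsOpen Ω) (hΩ : Bornology.IsBounded Ω) {p q : ℝ} (hp : 1 ≤ p)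
    (hq : 1 ≤ q) {u : E n → ℝ} {U V : E n → E n} (h : IsGradLimit s δ w Ω p u U)
    (h' : IsGradLimit s δ w Ω q u V) (j : Fin n) :
    ∀ᵐ x ∂volume.restrict Ω, U x j = V x j := by
  have hint : ∀ {p : ℝ} {U : E n → E n}, 1 ≤ p → IsGradLimit s δ w Ω p u U →
      IntegrableOn (fun x => U x j) Ω := fun {p U} hp h => by
    have : IsFiniteMeasure (volume.restrict Ω) := ⟨by simpa using hΩ.measure_lt_top⟩
    exact (h.2.1.eval_piLp j).integrable (by simpa using hp)
  have hU := hint hp h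
  have hV := hint hq h'
  have key := hΩo.ae_eq_zero_of_integral_contDiff_smul_eq_zero (μ := volume)
    (f := fun x => U x j - V x j) (hU.sub hV).locallyIntegrableOn fun φ hφ hφc hφΩ => by
      have hφt : IsTest Ω φ := ⟨hφ, hφc, hφΩ⟩
      have hbd := memLp_restrict_of_continuous hΩ hφ.continuous ⊤
      rw [← setIntegral_eq_integral_of_forall_compl_eq_zero (s := Ω) fun x hx => by
        rw [image_eq_zero_of_notMem_tsupport fun h => hx (hφΩ h), zero_smul]]
      simp only [smul_eq_mul, mul_sub]
      rw [integral_sub, h.integral_mul_test hn hs1 hδ hw hΩ hp hφt,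
        h'.integral_mul_test hn hs1 hδ hw hΩ hq hφt, sub_self]
      · exact memLp_one_iff_integrable.1 ((memLp_one_iff_integrable.2 hU).mul' hbd)
      · exact memLp_one_iff_integrable.1 ((memLp_one_iff_integrable.2 hV).mul' hbd)
  rw [ae_restrict_iff' hΩo.measurableSet]
  filter_upwards [key] with x hx hxΩ
  exact sub_eq_zero.1 (hx hxΩ)

/-- A linear relation between the cofactors that holds for all smooth fields passes to the
nonlocal gradients of fields in `H^{s,p,δ}(Ω)`, by convergence of the cofactors in `L¹`. -/
theorem integral_cof_mulVec_eq_zero (hn : 1 ≤ n) (hs1 : s < 1) (hδ : 0 < δ)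
    (hw : IsCutoff δ w) {Ω : Set (E n)} (hΩo : IsOpen Ω) (hΩ : Bornology.IsBounded Ω) {p : ℝ}
    (hp1 : 1 ≤ p) (hp : (n : ℝ) - 1 ≤ p) {u : E n → E n}
    (hu : ∀ i, MemH s δ w Ω p fun x => u x i) {U : E n → Matrix (Fin n) (Fin n) ℝ}
    (hU : ∀ i, IsNlGrad s δ w Ω (fun x => u x i) (row U i)) {ψ : E n → E n}
    (hψ : Continuous ψ)
    (hsmooth : ∀ v : E n → E n, IsTest Set.univ v → ∀ i,
      ∫ x in Ω, ∑ j, cof (nlGradMat s δ w v x) i j * ψ x j = 0) :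
    IntegrableOn (fun x => (cof (U x)).mulVec (ψ x).ofLp) Ω ∧
      ∫ x in Ω, (cof (U x)).mulVec (ψ x).ofLp = 0 := by
  have : IsFiniteMeasure (volume.restrict Ω) := ⟨by simpa using hΩ.measure_lt_top⟩
  choose V hV using hu
  choose v hv _ hvV using fun i => (hV i).exists_tendstoLp hn hs1 hw hΩ
  set B : E n → Matrix (Fin n) (Fin n) ℝ := fun x => Matrix.of fun i j => V i x j with hB
  have hUB : ∀ᵐ x ∂volume.restrict Ω, U x = B x := by
    have h : ∀ᵐ x ∂volume.restrict Ω, ∀ i j, row U i x j = V i x j :=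
      ae_all_iff.2 fun i => ae_all_iff.2 fun j =>
        IsGradLimit.ae_eq hn hs1 hδ hw hΩo hΩ le_rfl hp1 (hU i) (hV i) j
    filter_upwards [h] with x hx
    ext i j
    exact hx i j
  set vv : ℕ → E n → E n := fun k x => WithLp.toLp 2 fun i => v i k x with hvv
  have hvvt : ∀ k, IsTest Set.univ (vv k) := fun k => by
    refine ⟨contDiff_euclidean.2 fun i => (hv i k).1, ?_, Set.subset_univ _⟩
    refine HasCompactSupport.of_support_subset_isCompact
      (isCompact_iUnion fun i => (hv i k).2.1.isCompact) fun x hx => ?_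
    by_contra hcon
    rw [Set.mem_iUnion, not_exists] at hcon
    refine hx ?_
    ext i
    exact image_eq_zero_of_notMem_tsupport (f := v i k) (hcon i)
  have hcof : ∀ i j, TendstoLp (volume.restrict Ω) 1
      (fun k x => cof (nlGradMat s δ w (vv k) x) i j) fun x => cof (B x) i j := fun i j =>
    TendstoLp.cof hp (A := fun k x => nlGradMat s δ w (vv k) x) (B := B) (fun i j => hvV i j) i j
  have hsum : ∀ i, TendstoLp (volume.restrict Ω) 1
      (fun k => ∑ j, (fun x => ψ x j) * fun x => cof (nlGradMat s δ w (vv k) x) i j)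
      (∑ j, (fun x => ψ x j) * fun x => cof (B x) i j) := fun i =>
    TendstoLp.sum Finset.univ le_rfl fun j _ => (hcof i j).const_mul le_rfl
      (memLp_restrict_of_continuous hΩ ((EuclideanSpace.proj (𝕜 := ℝ) j).continuous.comp hψ) _)
  have hlim : ∀ i, ∫ x in Ω, (cof (B x)).mulVec (ψ x).ofLp i = 0 := fun i => by
    have h := (hsum i).tendsto_integral
    simp only [Finset.sum_apply, Pi.mul_apply, mul_comm (ψ _ _)] at h
    exact tendsto_nhds_unique h (tendsto_const_nhds.congr fun k => (hsmooth _ (hvvt k) i).symm)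
  have hint : ∀ i, Integrable (fun x => (cof (B x)).mulVec (ψ x).ofLp i) (volume.restrict Ω) :=
    fun i => (memLp_one_iff_integrable.1 (hsum i).memLp_lim).congr (ae_of_all _ fun x => by
      simp [Matrix.mulVec, dotProduct, mul_comm])
  have hae : (fun x => (cof (B x)).mulVec (ψ x).ofLp) =ᵐ[volume.restrict Ω]
      fun x => (cof (U x)).mulVec (ψ x).ofLp := by
    filter_upwards [hUB] with x hx
    rw [hx]
  refine ⟨(Integrable.of_eval hint).congr hae, ?_⟩
  rw [← integral_congr_ae hae]
  funext i
  rw [eval_integral hint]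
  exact hlim i

end

end NonlocalPiola

theorem proposition4p1 (n : ℕ) (hn : 1 ≤ n) (s δ : ℝ) (hs0 : 0 < s) (hs1 : s < 1) (hδ : 0 < δ)
    (w : E n → ℝ) (hw : IsCutoff δ w) :
    -- smooth case; each vanishing integral converges absolutely, each derivative exists
    (∀ u : E n → E n, IsTest Set.univ u →
      ((∀ i x, IntegrableOn (nlDivIntegrand s w (row (fun z => cof (nlGradMat s δ w u z)) i) x)
          (Metric.ball x δ)) ∧
        ∀ x, nlDivMat s δ w (fun z => cof (nlGradMat s δ w u z)) x = 0) ∧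
      ((∀ i j, ContDiff ℝ 1 (fun z => cof (nlGradMat s δ w u z) i j)) ∧
        ∀ x, divMat (fun z => cof (nlGradMat s δ w u z)) x = 0) ∧
      ((∀ i x, IntegrableOn (nlDivIntegrand s w (row (fun z => cof (jacobian u z)) i) x)
          (Metric.ball x δ)) ∧
        ∀ x, nlDivMat s δ w (fun z => cof (jacobian u z)) x = 0)) ∧
    -- the case of `u ∈ H^{s,p,δ}(Ω, ℝⁿ)` with nonlocal gradient `U`
    (∀ Ω : Set (E n), IsOpen Ω → Bornology.IsBounded Ω →
      ∀ p : ℝ, 1 ≤ p → (n : ℝ) - 1 ≤ p →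
      ∀ u : E n → E n, (∀ i, MemH s δ w Ω p (fun x => u x i)) →
      ∀ U : E n → Matrix (Fin n) (Fin n) ℝ,
        (∀ i, IsNlGrad s δ w Ω (fun x => u x i) (row U i)) →
      (∀ φ : E n → ℝ, IsTest (inset δ Ω) φ →
        IntegrableOn (fun x => (cof (U x)).mulVec (nlGrad s δ w φ x).ofLp) Ω ∧
        ∫ x in Ω, (cof (U x)).mulVec (nlGrad s δ w φ x).ofLp = 0) ∧
      (∀ φ : E n → ℝ, IsTest Ω φ →
        IntegrableOn (fun x => (cof (U x)).mulVec (gradient φ x).ofLp) Ω ∧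
        ∫ x in Ω, (cof (U x)).mulVec (gradient φ x).ofLp = 0)) := by
  refine ⟨fun u hu => ?_, fun Ω hΩo hΩ p hp1 hp u hu U hU => ⟨fun φ hφ => ?_, fun φ hφ => ?_⟩⟩
  · have hu2 : ContDiff ℝ 2 u := mod_cast contDiff_infty.1 hu.1 2
    have hA := contDiff_cof (contDiff_nlGradMat hn hs1 hw hu2)
    have hJ := contDiff_cof (contDiff_jacobian hu2)
    have hAd := sum_fderiv_cof_nlGradMat hn hs0 hs1 hδ hw hu2
    refine ⟨⟨fun i x => (integrable_nlDivIntegrand hn hs1 hw (hA i) x).integrableOn,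
        nlDivMat_eq_zero hn hs0 hs1 hδ hw hA hAd⟩, ⟨hA, fun x => funext fun i => hAd i x⟩,
      ⟨fun i x => (integrable_nlDivIntegrand hn hs1 hw (hJ i) x).integrableOn,
        nlDivMat_eq_zero hn hs0 hs1 hδ hw hJ (sum_fderiv_cof_jacobian hu2)⟩⟩
  · have hφ1 : ContDiff ℝ 1 φ := hφ.1.of_le (mod_cast le_top)
    refine integral_cof_mulVec_eq_zero hn hs1 hδ hw hΩo hΩ hp1 hp hu hU
      (continuous_nlGrad hn hs1 hw hφ1) fun v hv i => ?_
    have hv2 : ContDiff ℝ 2 v := mod_cast contDiff_infty.1 hv.1 2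
    rw [setIntegral_eq_integral_of_forall_compl_eq_zero fun x hx => by
      simp [nlGrad_eq_zero_of_notMem hn hs1 hδ hw hφ hx]]
    exact integral_sum_mul_nlGrad_eq_zero hn hs0 hs1 hδ hw
      (contDiff_cof (contDiff_nlGradMat hn hs1 hw hv2) i)
      (sum_fderiv_cof_nlGradMat hn hs0 hs1 hδ hw hv2 i) hφ1 hφ.2.1
  · have hφ1 : ContDiff ℝ 1 φ := hφ.1.of_le (mod_cast le_top)
    have hg : Continuous (gradient φ) :=
      (InnerProductSpace.toDual ℝ (E n)).symm.continuous.comp (hφ1.continuous_fderiv one_ne_zero)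
    refine integral_cof_mulVec_eq_zero hn hs1 hδ hw hΩo hΩ hp1 hp hu hU hg fun v hv i => ?_
    have hv2 : ContDiff ℝ 2 v := mod_cast contDiff_infty.1 hv.1 2
    rw [setIntegral_eq_integral_of_forall_compl_eq_zero fun x hx => by
      have : fderiv ℝ φ x = 0 := image_eq_zero_of_notMem_tsupport fun h =>
        hx (hφ.2.2 (tsupport_fderiv_subset ℝ h))
      simp [gradient, this]]
    exact integral_sum_mul_gradient_eq_zero (contDiff_cof (contDiff_nlGradMat hn hs1 hw hv2) i)
      (sum_fderiv_cof_nlGradMat hn hs0 hs1 hδ hw hv2 i) hφ1 hφ.2.1
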